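/- Let $n\ge 1$, let $f:\mathbb{R}^n\to\mathbb{R}^n$ be a computable Lipschitz function and let $z\in\mathbb{R}^n$. If $f(z)$ is computably random and $f$ is differentiable at $z$, then the derivative $f'(z)$ is not singular, i.e. $\det f'(z)\neq 0$. (Equivalently: if $f'(z)$ exists and is singular, then $f(z)$ is not computably random.) Here a family of reals $(r_a)$ indexed by natural numbers or finite strings is computable if there is a computable function $q$ with integer values such that $|r_a-q(a,k)2^{-k}|\le 2^{-k}$ for all $a,k$; a sequence in $\mathbb{R}^n$ is computable if its coordinate sequences are. A function $f:\mathbb{R}^n\to\mathbb{R}^n$ is computable if it maps computable sequences of points to computable sequences and there is a computable $d:\mathbb{N}^2\to\mathbb{N}$ such that $|x|,|y|\le N$ and $|x-y|\le 2^{-d(N,k)}$ imply $|f(x)-f(y)|\le 2^{-k}$. A martingale is a function $M:2^{<\omega}\to[0,\infty)$ with $M(\sigma0)+M(\sigma1)=2M(\sigma)$ for all $\sigma$. A sequence $Z\in 2^\omega$ is computably random if for every computable martingale $M$ the values of $M$ on the prefixes of $Z$ are bounded. A point of $\mathbb{R}^n$ is computably random if the sequence obtained by interleaving the binary expansions of the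 fractional parts of its coordinates is computably random. -/

import Mathlib

open scoped NNReal

namespace CompRandom

/-- `g a` is a computable real, uniformly in `a`: from `a` and `k` one can compute an integer `m`
with `|g a - m / 2 ^ k| ≤ 2 ^ (-k)`. -/
def ComputableReals {α : Type} [Primcodable α] (g : α → ℝ) : Prop :=
  ∃ q : α → ℕ → ℤ, Computable₂ q ∧ ∀ a k, |g a - (q a k : ℝ) / 2 ^ k| ≤ (1 / 2 : ℝ) ^ k

/-- A computable sequence of points of `ℝⁿ`. -/
def ComputableSeq {n : ℕ} (x : ℕ → EuclideanSpace ℝ (Fin n)) : Prop :=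
  ∀ i, ComputableReals fun k => x k i

/-- A computable function `ℝⁿ → ℝᵐ` (Grzegorczyk; Pour-El and Richards): it maps computable
sequences to computable sequences, and it has a computable modulus of uniform continuity on the
ball of radius `N`, uniformly in `N`. -/
structure ComputableMap {n m : ℕ}
    (f : EuclideanSpace ℝ (Fin n) → EuclideanSpace ℝ (Fin m)) : Prop where
  seq : ∀ x : ℕ → EuclideanSpace ℝ (Fin n), ComputableSeq x → ComputableSeq fun k => f (x k)
  modulus : ∃ d : ℕ → ℕ → ℕ, Computable₂ d ∧
    ∀ (N k : ℕ) (x y : EuclideanSpace ℝ (Fin n)), ‖x‖ ≤ N → ‖y‖ ≤ N →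
      ‖x - y‖ ≤ (1 / 2 : ℝ) ^ d N k → ‖f x - f y‖ ≤ (1 / 2 : ℝ) ^ k

/-- A martingale (betting strategy) on finite binary strings. -/
structure IsMartingale (M : List (Fin 2) → ℝ) : Prop where
  nonneg : ∀ σ, 0 ≤ M σ
  fair : ∀ σ, M (σ ++ [0]) + M (σ ++ [1]) = 2 * M σ

/-- The martingale `M` succeeds on `Z` if its capital along the prefixes of `Z` is unbounded. -/
def Succeeds (M : List (Fin 2) → ℝ) (Z : ℕ → Fin 2) : Prop :=
  ∀ c : ℝ, ∃ m : ℕ, c < M ((List.range m).map Z)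

/-- An infinite binary sequence is computably random if no computable martingale succeeds
on it. -/
def SeqComputablyRandom (Z : ℕ → Fin 2) : Prop :=
  ∀ M : List (Fin 2) → ℝ, IsMartingale M → ComputableReals M → ¬ Succeeds M Z

/-- The binary expansion of (the fractional part of) `z ∈ ℝⁿ`: the expansions of the fractional
parts of the coordinates, interleaved. -/
noncomputable def binaryExpansion {n : ℕ} [NeZero n] (z : EuclideanSpace ℝ (Fin n)) :
    ℕ → Fin 2 :=
  fun k => Real.digits (Int.fract (z (Fin.ofNat n k))) 2 (k / n)

/-- A point of `ℝⁿ` is computably random if its binary expansion is. -/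
def ComputablyRandom {n : ℕ} [NeZero n] (z : EuclideanSpace ℝ (Fin n)) : Prop :=
  SeqComputablyRandom (binaryExpansion z)

end CompRandom

/-! Suppose f'(z) kills a vector w ≠ 0 and let L be a Lipschitz constant. Near z the function f
varies along w only by o(distance), so for any N and all small ρ there are N disjoint balls of
radius ρ/(2L), centred on the line through z in direction w, that f maps into the ball of radius ρ
about f(z) (`le_volume_preimage_of_singular`). The image under f of the uniform measure therefore
has infinite density at f(z). The density of a measure on dyadic boxes is a martingale, and this one
should succeed on the expansion of f(z).

Two obstacles remain. First, the measure of the preimage of a sharp box need not be computable. So a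
point u is assigned a random bit sequence instead of its expansion: each bit is 1 with a probability
that is a steep but continuous function of u (`softBet`). The probability of extending σ is then
Lipschitz in u, and its integral over the cube is computable by Riemann sums
(`computableReals_pushProb`).

Second, points near f(z) must still give substantial weight to the box of f(z). Here randomness of
f(z) is used again. By `SeqComputablyRandom.eventually_not_run`, f(z) is at distance at least
2^(-(2p+1)) from the cut made at every late stage p. By `SeqComputablyRandom.frequently_pattern`,
for infinitely many k every coordinate has digits 0, 1 at places k, k + 1, so f(z) is at distance of
order 2^(-k) from the faces of its cube of side 2^(-k). For such k, `le_treeProb_softBet` bounds the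
weight below by a constant 2^(-B), and the capital on the prefix of length kn is at least a constant
times N, with N arbitrary. -/

namespace CompRandom

/-! ### Primitive recursive integer and dyadic arithmetic -/

section IntArithmetic

theorem encode_int_natCast (m : ℕ) : Encodable.encode (m : ℤ) = 2 * m := by
  rfl

theorem encode_int_negSucc (m : ℕ) : Encodable.encode (Int.negSucc m) = 2 * m + 1 := by
  rfl

theorem primrec_intNatCast : Primrec (fun m : ℕ => (m : ℤ)) :=
  Primrec.encode_iff.1 (Primrec.nat_double.of_eq fun m => (encode_int_natCast m).symm)

/-- Works on codes: even codes are the nonnegative integers, odd codes the negative ones. The other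
integer operations reduce to this one by splitting into positive and negative parts. -/
theorem primrec_intNatSub : Primrec₂ (fun m k : ℕ => (m : ℤ) - k) := by
  refine Primrec.encode_iff.1 ?_
  have : Primrec fun p : ℕ × ℕ => if p.2 ≤ p.1 then 2 * (p.1 - p.2) else 2 * (p.2 - p.1 - 1) + 1 :=
    Primrec.ite (Primrec.nat_le.comp Primrec.snd Primrec.fst)
      (Primrec.nat_double.comp (Primrec.nat_sub.comp Primrec.fst Primrec.snd))
      (Primrec.nat_double_succ.comp (Primrec.nat_sub.comp
        (Primrec.nat_sub.comp Primrec.snd Primrec.fst) (Primrec.const 1)))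
  refine this.of_eq fun p => ?_
  obtain ⟨m, k⟩ := p
  dsimp only
  split_ifs with h
  · rw [← encode_int_natCast]; congr 1; omega
  · rw [← encode_int_negSucc]; congr 1; omega

theorem primrec_intToNat : Primrec Int.toNat := by
  have : Primrec fun z : ℤ => if (Encodable.encode z) % 2 = 0 then (Encodable.encode z) / 2 else 0 :=
    Primrec.ite (Primrec.eq.comp (Primrec.nat_mod.comp Primrec.encode (Primrec.const 2))
      (Primrec.const 0)) (Primrec.nat_div.comp Primrec.encode (Primrec.const 2)) (Primrec.const 0)
  refine this.of_eq fun z => ?_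
  cases z with
  | ofNat m =>
    have := encode_int_natCast m
    simp only [Int.ofNat_eq_natCast, this, Int.toNat_natCast]
    split_ifs <;> omega
  | negSucc m =>
    have := encode_int_negSucc m
    simp only [this, Int.toNat_negSucc]
    split_ifs <;> omega

theorem primrec_intNegToNat : Primrec fun z : ℤ => (-z).toNat := by
  have : Primrec fun z : ℤ => if (Encodable.encode z) % 2 = 0 then 0 else
      (Encodable.encode z) / 2 + 1 :=
    Primrec.ite (Primrec.eq.comp (Primrec.nat_mod.comp Primrec.encode (Primrec.const 2))
      (Primrec.const 0)) (Primrec.const 0)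
      (Primrec.succ.comp (Primrec.nat_div.comp Primrec.encode (Primrec.const 2)))
  refine this.of_eq fun z => ?_
  cases z with
  | ofNat m =>
    have := encode_int_natCast m
    simp only [Int.ofNat_eq_natCast, this]
    split_ifs <;> omega
  | negSucc m =>
    have := encode_int_negSucc m
    simp only [this]
    split_ifs <;> omega

theorem primrec_intNeg : Primrec fun z : ℤ => -z :=
  (primrec_intNatSub.comp primrec_intNegToNat primrec_intToNat).of_eq fun z => by omega

theorem primrec_intAdd : Primrec₂ fun a b : ℤ => a + b :=
  (primrec_intNatSub.comp
    (Primrec.nat_add.comp (primrec_intToNat.comp Primrec.fst) (primrec_intToNat.comp Primrec.snd))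
    (Primrec.nat_add.comp (primrec_intNegToNat.comp Primrec.fst)
      (primrec_intNegToNat.comp Primrec.snd))).of_eq fun p => by push_cast; omega

theorem primrec_natPow : Primrec₂ ((· ^ ·) : ℕ → ℕ → ℕ) :=
  Primrec₂.unpaired'.1 Nat.Primrec.pow

theorem primrec_two_pow : Primrec fun k : ℕ => 2 ^ k :=
  primrec_natPow.comp (Primrec.const 2) Primrec.id

/-- The integer nearest to `x / d`. -/
def natRound (x d : ℕ) : ℕ := (2 * x + d) / (2 * d)

theorem primrec_natRound : Primrec₂ natRound :=
  Primrec.nat_div.comp (Primrec.nat_add.comp (Primrec.nat_double.comp Primrec.fst) Primrec.snd)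
    (Primrec.nat_double.comp Primrec.snd)

theorem natRound_zero {d : ℕ} (hd : 0 < d) : natRound 0 d = 0 :=
  Nat.div_eq_of_lt (by omega)

theorem abs_div_sub_natRound_le (x : ℕ) {d : ℕ} (hd : 0 < d) :
    |(x : ℝ) / d - natRound x d| ≤ 1 / 2 := by
  have hd' : (0 : ℝ) < d := by exact_mod_cast hd
  set r := natRound x d with hr
  have h1 : r * (2 * d) ≤ 2 * x + d := Nat.div_mul_le_self _ _
  have h2 : 2 * x + d < 2 * d * (r + 1) :=
    Nat.lt_mul_div_succ (2 * x + d) (by positivity : 0 < 2 * d)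
  have h1' : (r : ℝ) * (2 * d) ≤ 2 * x + d := by exact_mod_cast h1
  have h2' : (2 : ℝ) * x + d ≤ 2 * d * (r + 1) := by exact_mod_cast h2.le
  have hx : (x : ℝ) = x / d * d := by field_simp
  rw [abs_le]
  constructor
  · by_contra! h
    nlinarith
  · by_contra! h
    nlinarith

/-- The integer nearest to `x * 2 ^ k / 2 ^ b`, ties rounded away from zero. -/
def rescale (x : ℤ) (k b : ℕ) : ℤ :=
  (natRound (x.toNat * 2 ^ k) (2 ^ b) : ℤ) - natRound ((-x).toNat * 2 ^ k) (2 ^ b)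

theorem computable_rescale {α : Type*} [Primcodable α] {x : α → ℤ} {k b : α → ℕ}
    (hx : Computable x) (hk : Computable k) (hb : Computable b) :
    Computable fun a => rescale (x a) (k a) (b a) := by
  have hb' : Computable fun a => 2 ^ b a := primrec_two_pow.to_comp.comp hb
  have hk' : Computable fun a => 2 ^ k a := primrec_two_pow.to_comp.comp hk
  have key : ∀ t : ℤ → ℕ, Primrec t → Computable fun a =>
      natRound (t (x a) * 2 ^ k a) (2 ^ b a) := fun t ht =>
    primrec_natRound.to_comp.comp (Primrec.nat_mul.to_comp.comp (ht.to_comp.comp hx) hk') hb'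
  exact (primrec_intNatSub.to_comp.comp (key _ primrec_intToNat)
    (key _ primrec_intNegToNat)).of_eq fun a => by rw [rescale]

theorem abs_rescale_sub_le (x : ℤ) (k b : ℕ) :
    |(x : ℝ) * 2 ^ k / 2 ^ b - rescale x k b| ≤ 1 / 2 := by
  have h2 : 0 < 2 ^ b := by positivity
  rcases Int.le_total 0 x with hx | hx
  · lift x to ℕ using hx
    have := abs_div_sub_natRound_le (x * 2 ^ k) h2
    have e : (-(x : ℤ)).toNat = 0 := by omega
    rw [rescale, e, zero_mul, natRound_zero h2, Int.toNat_natCast]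
    push_cast at this ⊢
    rwa [sub_zero]
  · obtain ⟨y, rfl⟩ : ∃ y : ℕ, x = -(y : ℤ) := ⟨x.natAbs, by omega⟩
    have := abs_div_sub_natRound_le (y * 2 ^ k) h2
    have e : (-(y : ℤ)).toNat = 0 := by omega
    rw [rescale, e, zero_mul, natRound_zero h2, neg_neg, Int.toNat_natCast, ← abs_neg]
    push_cast at this ⊢
    convert this using 2
    ring

end IntArithmetic

/-! ### Closure properties of computable reals -/

namespace ComputableReals

variable {α β : Type} [Primcodable α] [Primcodable β]

theorem comp {g : β → ℝ} (hg : ComputableReals g) {h : α → β} (hh : Computable h) :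
    ComputableReals fun a => g (h a) := by
  obtain ⟨q, hq, H⟩ := hg
  exact ⟨fun a k => q (h a) k, hq.comp (hh.comp Computable.fst) Computable.snd, fun a k => H _ _⟩

/-- A real-valued function with computable dyadic approximations of any precision is
computable. -/
theorem of_dyadic_approx {g : α → ℝ} {x : α → ℕ → ℤ} {b : α → ℕ → ℕ}
    (hx : Computable₂ x) (hb : Computable₂ b)
    (H : ∀ a k, |g a - (x a k : ℝ) / 2 ^ b a k| ≤ (1 / 2 : ℝ) ^ k) : ComputableReals g := by
  refine ⟨fun a k => rescale (x a (k + 1)) k (b a (k + 1)), ?_, fun a k => ?_⟩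
  · have h1 : Computable fun p : α × ℕ => p.2 + 1 := Computable.succ.comp Computable.snd
    exact computable_rescale (hx.comp Computable.fst h1) Computable.snd (hb.comp Computable.fst h1)
  · have h1 := H a (k + 1)
    have h2 := abs_rescale_sub_le (x a (k + 1)) k (b a (k + 1))
    set X : ℝ := (x a (k + 1) : ℝ)
    set R : ℝ := ((rescale (x a (k + 1)) k (b a (k + 1)) : ℤ) : ℝ)
    set D : ℝ := 2 ^ b a (k + 1)
    have e : X / D - R / 2 ^ k = (X * 2 ^ k / D - R) * (1 / 2) ^ k := by
      rw [one_div, inv_pow]; field_simp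
    have h3 : |X / D - R / 2 ^ k| ≤ 1 / 2 * (1 / 2) ^ k := by
      rw [e, abs_mul, abs_of_pos (by positivity : (0 : ℝ) < (1 / 2) ^ k)]
      gcongr
    calc |g a - R / 2 ^ k| ≤ |g a - X / D| + |X / D - R / 2 ^ k| := abs_sub_le _ _ _
      _ ≤ (1 / 2) ^ (k + 1) + 1 / 2 * (1 / 2) ^ k := add_le_add h1 h3
      _ = (1 / 2) ^ k := by ring

theorem dyadic {x : α → ℤ} {b : α → ℕ} (hx : Computable x) (hb : Computable b) :
    ComputableReals fun a => (x a : ℝ) / 2 ^ b a :=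
  of_dyadic_approx (x := fun a _ => x a) (b := fun a _ => b a) (hx.comp Computable.fst)
    (hb.comp Computable.fst) fun a k => by simp

theorem intCast {x : α → ℤ} (hx : Computable x) : ComputableReals fun a => (x a : ℝ) :=
  by simpa using dyadic hx (Computable.const (0 : ℕ))

theorem natCast {x : α → ℕ} (hx : Computable x) : ComputableReals fun a => (x a : ℝ) :=
  by simpa using intCast (primrec_intNatCast.to_comp.comp hx)

theorem inv_two_pow {b : α → ℕ} (hb : Computable b) : ComputableReals fun a => (1 / 2 : ℝ) ^ b a :=
  by simpa using dyadic (Computable.const (1 : ℤ)) hb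

theorem const_div_two_pow (x : ℤ) (b : ℕ) : ComputableReals fun _ : α => (x : ℝ) / 2 ^ b :=
  dyadic (Computable.const x) (Computable.const b)

/-- Limits with an explicit rate, such as infinite sums and Riemann sums, stay computable: half of
the error is spent on the limit and half on the approximation. -/
theorem of_tendsto {g : α → ℝ} {h : α × ℕ → ℝ} (hh : ComputableReals h)
    (H : ∀ a k, |g a - h (a, k)| ≤ (1 / 2 : ℝ) ^ k) : ComputableReals g := by
  obtain ⟨q, hq, Hq⟩ := hh
  have h1 : Computable fun p : α × ℕ => p.2 + 1 := Computable.succ.comp Computable.snd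
  refine of_dyadic_approx (x := fun a k => q (a, k + 1) (k + 1)) (b := fun a k => k + 1)
    (hq.comp (Computable.fst.pair h1) h1) h1 fun a k => ?_
  calc _ ≤ |g a - h (a, k + 1)| + |h (a, k + 1) - q (a, k + 1) (k + 1) / 2 ^ (k + 1)| :=
        abs_sub_le _ _ _
    _ ≤ (1 / 2) ^ (k + 1) + (1 / 2) ^ (k + 1) := add_le_add (H _ _) (Hq _ _)
    _ = (1 / 2) ^ k := by ring

theorem neg {g : α → ℝ} (hg : ComputableReals g) : ComputableReals fun a => -g a := by
  obtain ⟨q, hq, H⟩ := hg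
  refine ⟨fun a k => -q a k, primrec_intNeg.to_comp.comp hq, fun a k => ?_⟩
  rw [← abs_neg]
  convert H a k using 2
  push_cast; ring

theorem add {g h : α → ℝ} (hg : ComputableReals g) (hh : ComputableReals h) :
    ComputableReals fun a => g a + h a := by
  obtain ⟨q, hq, H⟩ := hg
  obtain ⟨r, hr, H'⟩ := hh
  have h1 : Computable fun p : α × ℕ => p.2 + 1 := Computable.succ.comp Computable.snd
  refine of_dyadic_approx (x := fun a k => q a (k + 1) + r a (k + 1)) (b := fun _ k => k + 1)
    (primrec_intAdd.to_comp.comp (hq.comp Computable.fst h1) (hr.comp Computable.fst h1)) h1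
    fun a k => ?_
  have e : g a + h a - ((q a (k + 1) + r a (k + 1) : ℤ) : ℝ) / 2 ^ (k + 1) =
      (g a - q a (k + 1) / 2 ^ (k + 1)) + (h a - r a (k + 1) / 2 ^ (k + 1)) := by
    push_cast; ring
  rw [e]
  calc _ ≤ _ := abs_add_le _ _
    _ ≤ (1 / 2) ^ (k + 1) + (1 / 2) ^ (k + 1) := add_le_add (H _ _) (H' _ _)
    _ = (1 / 2) ^ k := by ring

theorem sub {g h : α → ℝ} (hg : ComputableReals g) (hh : ComputableReals h) :
    ComputableReals fun a => g a - h a := by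
  simpa [sub_eq_add_neg] using hg.add hh.neg

theorem two_pow_mul {g : α → ℝ} (hg : ComputableReals g) {e : α → ℕ} (he : Computable e) :
    ComputableReals fun a => 2 ^ e a * g a := by
  obtain ⟨q, hq, H⟩ := hg
  refine ⟨fun a k => q a (k + e a), hq.comp Computable.fst
    (Primrec.nat_add.to_comp.comp Computable.snd (he.comp Computable.fst)), fun a k => ?_⟩
  have := H a (k + e a)
  have e1 : 2 ^ e a * g a - (q a (k + e a) : ℝ) / 2 ^ k =
      2 ^ e a * (g a - q a (k + e a) / 2 ^ (k + e a)) := by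
    rw [pow_add]; field_simp
  rw [e1, abs_mul, abs_of_pos (by positivity : (0 : ℝ) < 2 ^ e a)]
  calc _ ≤ (2 : ℝ) ^ e a * (1 / 2) ^ (k + e a) := by gcongr
    _ = (1 / 2) ^ k := by
      rw [pow_add, one_div, inv_pow, inv_pow]; field_simp

theorem div_two_pow {g : α → ℝ} (hg : ComputableReals g) {e : α → ℕ} (he : Computable e) :
    ComputableReals fun a => g a / 2 ^ e a := by
  obtain ⟨q, hq, H⟩ := hg
  refine of_dyadic_approx (x := q) (b := fun a k => k + e a) hq
    (Primrec.nat_add.to_comp.comp Computable.snd (he.comp Computable.fst)) fun a k => ?_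
  have e1 : g a / 2 ^ e a - (q a k : ℝ) / 2 ^ (k + e a) = (g a - q a k / 2 ^ k) / 2 ^ e a := by
    rw [pow_add]; field_simp
  rw [e1, abs_div, abs_of_pos (by positivity : (0 : ℝ) < 2 ^ e a)]
  exact (div_le_self (abs_nonneg _) (one_le_pow₀ (by norm_num))).trans (H a k)

theorem cond {c : α → Bool} (hc : Computable c) {g h : α → ℝ} (hg : ComputableReals g)
    (hh : ComputableReals h) : ComputableReals fun a => bif c a then g a else h a := by
  obtain ⟨q, hq, H⟩ := hg
  obtain ⟨r, hr, H'⟩ := hh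
  refine ⟨fun a k => bif c a then q a k else r a k,
    Computable.cond (hc.comp Computable.fst) hq hr, fun a k => ?_⟩
  dsimp only
  cases c a
  · exact H' a k
  · exact H a k

end ComputableReals

/-- The nearest point of `[0, 1]`. -/
noncomputable def clamp (x : ℝ) : ℝ := max 0 (min x 1)

theorem clamp_nonneg (x : ℝ) : 0 ≤ clamp x := le_max_left _ _

theorem clamp_le_one (x : ℝ) : clamp x ≤ 1 := max_le zero_le_one (min_le_right _ _)

theorem clamp_of_mem {x : ℝ} (h0 : 0 ≤ x) (h1 : x ≤ 1) : clamp x = x := by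
  simp [clamp, h0, h1]

theorem clamp_mono : Monotone clamp := fun x y h => by unfold clamp; gcongr

theorem abs_clamp_sub_clamp_le (x y : ℝ) : |clamp x - clamp y| ≤ |x - y| := by
  unfold clamp
  refine (abs_max_sub_max_le_max _ _ _ _).trans ?_
  rw [sub_self, abs_zero, max_eq_right (abs_nonneg _)]
  refine (abs_min_sub_min_le_max _ _ _ _).trans ?_
  rw [sub_self, abs_zero, max_eq_left (abs_nonneg _)]

/-- `clamp` on numerators of fractions with denominator `2 ^ k`. -/
def clampNum (k : ℕ) (x : ℤ) : ℕ := min x.toNat (2 ^ k)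

theorem primrec_clampNum : Primrec₂ clampNum :=
  Primrec.nat_min.comp (primrec_intToNat.comp Primrec.snd) (primrec_two_pow.comp Primrec.fst)

theorem clampNum_div (k : ℕ) (x : ℤ) : (clampNum k x : ℝ) / 2 ^ k = clamp ((x : ℝ) / 2 ^ k) := by
  have h2 : (0 : ℝ) < 2 ^ k := by positivity
  unfold clampNum clamp
  rcases Int.le_total 0 x with hx | hx
  · lift x to ℕ using hx
    rw [max_eq_right (le_min (by positivity) zero_le_one), Int.toNat_natCast]
    push_cast
    rcases le_total (x : ℝ) (2 ^ k) with h | h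
    · rw [min_eq_left h, min_eq_left ((div_le_one h2).2 h)]
    · rw [min_eq_right h, min_eq_right ((one_le_div h2).2 h), div_self h2.ne']
  · have hx' : (x : ℝ) / 2 ^ k ≤ 0 := div_nonpos_of_nonpos_of_nonneg (by exact_mod_cast hx) h2.le
    rw [Int.toNat_of_nonpos hx, max_eq_left ((min_le_left _ _).trans hx')]
    simp

/-- Exchanging one factor at a time, the remaining factors do not amplify the error. -/
theorem abs_prod_sub_prod_le {ι : Type*} (s : Finset ι) (g h : ι → ℝ)
    (hg : ∀ i ∈ s, |g i| ≤ 1) (hh : ∀ i ∈ s, |h i| ≤ 1) :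
    |∏ i ∈ s, g i - ∏ i ∈ s, h i| ≤ ∑ i ∈ s, |g i - h i| := by
  classical
  induction s using Finset.induction_on with
  | empty => simp
  | insert i s hi ih =>
    rw [Finset.prod_insert hi, Finset.prod_insert hi, Finset.sum_insert hi]
    have ih' := ih (fun j hj => hg j (Finset.mem_insert_of_mem hj))
      (fun j hj => hh j (Finset.mem_insert_of_mem hj))
    have hp : |∏ j ∈ s, g j| ≤ 1 := by
      rw [Finset.abs_prod]
      exact Finset.prod_le_one (fun _ _ => abs_nonneg _)
        fun j hj => hg j (Finset.mem_insert_of_mem hj)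
    have e : g i * ∏ j ∈ s, g j - h i * ∏ j ∈ s, h j =
      (g i - h i) * ∏ j ∈ s, g j + h i * (∏ j ∈ s, g j - ∏ j ∈ s, h j) := by ring
    rw [e]
    refine (abs_add_le _ _).trans (add_le_add ?_ ?_)
    · rw [abs_mul]
      exact mul_le_of_le_one_right (abs_nonneg _) hp
    · rw [abs_mul]
      exact (mul_le_of_le_one_left (abs_nonneg _) (hh i (Finset.mem_insert_self _ _))).trans ih'

namespace ComputableReals

variable {α β : Type} [Primcodable α] [Primcodable β]

theorem clamp {g : α → ℝ} (hg : ComputableReals g) : ComputableReals fun a => clamp (g a) := by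
  obtain ⟨q, hq, H⟩ := hg
  refine ⟨fun a k => (clampNum k (q a k) : ℤ), primrec_intNatCast.to_comp.comp
    (primrec_clampNum.to_comp.comp Computable.snd hq), fun a k => ?_⟩
  rw [Int.cast_natCast, clampNum_div]
  exact (abs_clamp_sub_clamp_le _ _).trans (H a k)

theorem sum_range {g : α × ℕ → ℝ} (hg : ComputableReals g) {b : α → ℕ} (hb : Computable b) :
    ComputableReals fun a => ∑ i ∈ Finset.range (b a), g (a, i) := by
  obtain ⟨q, hq, H⟩ := hg
  have hkb : Computable fun p : α × ℕ => p.2 + b p.1 :=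
    Primrec.nat_add.to_comp.comp Computable.snd (hb.comp Computable.fst)
  refine of_dyadic_approx
    (x := fun a k => Nat.rec (0 : ℤ) (fun i s => s + q (a, i) (k + b a)) (b a))
    -- The `b a` extra bits absorb the number of summands, since `b a ≤ 2 ^ b a`.
    (b := fun a k => k + b a) ?_ hkb fun a k => ?_
  · have hstep : Computable₂ fun (p : α × ℕ) (r : ℕ × ℤ) =>
        r.2 + q (p.1, r.1) (p.2 + b p.1) :=
      primrec_intAdd.to_comp.comp (Computable.snd.comp Computable.snd)
        (hq.comp ((Computable.fst.comp Computable.fst).pair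
          (Computable.fst.comp Computable.snd)) (hkb.comp Computable.fst))
    exact Computable.nat_rec (hb.comp Computable.fst) (Computable.const 0) hstep
  · have e : ∀ m : ℕ, ((Nat.rec (0 : ℤ) (fun i s => s + q (a, i) (k + b a)) m : ℤ) : ℝ) =
        ∑ i ∈ Finset.range m, (q (a, i) (k + b a) : ℝ) := by
      intro m
      induction m with
      | zero => simp
      | succ m ih => rw [Finset.sum_range_succ, ← ih]; push_cast; rfl
    rw [e, Finset.sum_div, ← Finset.sum_sub_distrib]
    refine (Finset.abs_sum_le_sum_abs _ _).trans ?_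
    refine (Finset.sum_le_card_nsmul _ _ ((1 / 2 : ℝ) ^ (k + b a)) fun i _ => H _ _).trans ?_
    rw [Finset.card_range, nsmul_eq_mul, pow_add, mul_left_comm]
    refine mul_le_of_le_one_right (by positivity) ?_
    rw [one_div, inv_pow, ← div_eq_mul_inv, div_le_one (by positivity)]
    exact_mod_cast Nat.lt_two_pow_self.le

/-- The approximations are clamped to [0, 1] as well, so that the errors of the factors merely add
up. -/
theorem prod_range {g : α × ℕ → ℝ} (hg : ComputableReals g) (h0 : ∀ p, 0 ≤ g p)
    (h1 : ∀ p, g p ≤ 1) {b : α → ℕ} (hb : Computable b) :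
    ComputableReals fun a => ∏ i ∈ Finset.range (b a), g (a, i) := by
  obtain ⟨q, hq, H⟩ := hg
  have hkb : Computable fun p : α × ℕ => p.2 + b p.1 :=
    Primrec.nat_add.to_comp.comp Computable.snd (hb.comp Computable.fst)
  refine of_dyadic_approx
    (x := fun a k => ((Nat.rec (1 : ℕ) (fun i s => s * clampNum (k + b a) (q (a, i) (k + b a)))
      (b a) : ℕ) : ℤ))
    (b := fun a k => (k + b a) * b a) ?_
    (Primrec.nat_mul.to_comp.comp hkb (hb.comp Computable.fst)) fun a k => ?_
  · have hstep : Computable₂ fun (p : α × ℕ) (r : ℕ × ℕ) =>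
        r.2 * clampNum (p.2 + b p.1) (q (p.1, r.1) (p.2 + b p.1)) :=
      Primrec.nat_mul.to_comp.comp (Computable.snd.comp Computable.snd)
        (primrec_clampNum.to_comp.comp (hkb.comp Computable.fst)
          (hq.comp ((Computable.fst.comp Computable.fst).pair
            (Computable.fst.comp Computable.snd)) (hkb.comp Computable.fst)))
    exact primrec_intNatCast.to_comp.comp
      (Computable.nat_rec (hb.comp Computable.fst) (Computable.const 1) hstep)
  · have e : ∀ m : ℕ, ((Nat.rec (1 : ℕ) (fun i s => s * clampNum (k + b a) (q (a, i) (k + b a))) m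
        : ℕ) : ℝ) / 2 ^ ((k + b a) * m) =
        ∏ i ∈ Finset.range m, CompRandom.clamp ((q (a, i) (k + b a) : ℝ) / 2 ^ (k + b a)) := by
      intro m
      induction m with
      | zero => simp
      | succ m ih =>
        rw [Finset.prod_range_succ, ← ih, ← clampNum_div, mul_add, pow_add, mul_one]
        push_cast
        field_simp
    rw [Int.cast_natCast, e]
    refine (abs_prod_sub_prod_le _ _ _ (fun i _ => ?_) (fun i _ => ?_)).trans ?_
    · rw [abs_of_nonneg (h0 _)]; exact h1 _
    · rw [abs_of_nonneg (clamp_nonneg _)]; exact clamp_le_one _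
    refine (Finset.sum_le_card_nsmul _ _ ((1 / 2 : ℝ) ^ (k + b a)) fun i _ => ?_).trans ?_
    · rw [← clamp_of_mem (h0 (a, i)) (h1 (a, i))]
      exact (abs_clamp_sub_clamp_le _ _).trans (H _ _)
    rw [Finset.card_range, nsmul_eq_mul, pow_add, mul_left_comm]
    refine mul_le_of_le_one_right (by positivity) ?_
    rw [one_div, inv_pow, ← div_eq_mul_inv, div_le_one (by positivity)]
    exact_mod_cast Nat.lt_two_pow_self.le

end ComputableReals

/-! ### Martingales from conditional probabilities -/

/-- The length `m` prefix of an infinite sequence. -/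
def initSeg (Z : ℕ → Fin 2) (m : ℕ) : List (Fin 2) := (List.range m).map Z

@[simp] theorem length_initSeg (Z : ℕ → Fin 2) (m : ℕ) : (initSeg Z m).length = m := by
  simp [initSeg]

theorem initSeg_succ (Z : ℕ → Fin 2) (m : ℕ) : initSeg Z (m + 1) = initSeg Z m ++ [Z m] := by
  simp [initSeg, List.range_succ]

theorem getD_initSeg (Z : ℕ → Fin 2) {m p : ℕ} (h : p < m) : (initSeg Z m).getD p 0 = Z p := by
  simp [initSeg, List.getD, h]

/-- The probability that a random sequence extends `σ`, if the bit following `τ` is `1` with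
conditional probability `s τ`. -/
noncomputable def treeProb (s : List (Fin 2) → ℝ) (σ : List (Fin 2)) : ℝ :=
  ∏ p ∈ Finset.range σ.length,
    if σ.getD p 0 = 1 then s (σ.take p) else 1 - s (σ.take p)

theorem treeProb_concat (s : List (Fin 2) → ℝ) (σ : List (Fin 2)) (b : Fin 2) :
    treeProb s (σ ++ [b]) = treeProb s σ * if b = 1 then s σ else 1 - s σ := by
  unfold treeProb
  rw [List.length_append, List.length_singleton, Finset.prod_range_succ]
  congr 1
  · refine Finset.prod_congr rfl fun p hp => ?_
    have hp' : p < σ.length := Finset.mem_range.1 hp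
    rw [List.getD_append _ _ _ _ hp', List.take_append_of_le_length hp'.le]
  · simp

theorem treeProb_initSeg (s : List (Fin 2) → ℝ) (Z : ℕ → Fin 2) (m : ℕ) :
    treeProb s (initSeg Z m) =
      ∏ p ∈ Finset.range m, if Z p = 1 then s (initSeg Z p) else 1 - s (initSeg Z p) := by
  induction m with
  | zero => simp [treeProb]
  | succ m ih => rw [initSeg_succ, treeProb_concat, ih, Finset.prod_range_succ]

theorem treeProb_add (s : List (Fin 2) → ℝ) (σ : List (Fin 2)) :
    treeProb s (σ ++ [0]) + treeProb s (σ ++ [1]) = treeProb s σ := by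
  simp only [treeProb_concat, zero_ne_one, if_false, if_true]
  ring

theorem treeProb_nonneg {s : List (Fin 2) → ℝ} (h0 : ∀ τ, 0 ≤ s τ) (h1 : ∀ τ, s τ ≤ 1)
    (σ : List (Fin 2)) : 0 ≤ treeProb s σ :=
  Finset.prod_nonneg fun p _ => by
    split_ifs
    · exact h0 _
    · exact sub_nonneg.2 (h1 _)

theorem treeProb_le_one {s : List (Fin 2) → ℝ} (h0 : ∀ τ, 0 ≤ s τ) (h1 : ∀ τ, s τ ≤ 1)
    (σ : List (Fin 2)) : treeProb s σ ≤ 1 :=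
  Finset.prod_le_one
    (fun p _ => by
      split_ifs
      · exact h0 _
      · exact sub_nonneg.2 (h1 _))
    (fun p _ => by
      split_ifs
      · exact h1 _
      · exact sub_le_self _ (h0 _))

/-- The ratio of any probability measure to the uniform one is a martingale. -/
theorem isMartingale_treeProb {s : List (Fin 2) → ℝ} (h0 : ∀ τ, 0 ≤ s τ) (h1 : ∀ τ, s τ ≤ 1) :
    IsMartingale fun σ => 2 ^ σ.length * treeProb s σ where
  nonneg σ := mul_nonneg (by positivity) (treeProb_nonneg h0 h1 σ)
  fair σ := by
    simp only [List.length_append, List.length_singleton]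
    rw [← mul_add, treeProb_add, pow_succ]
    ring

theorem ComputableReals.ite {α : Type} [Primcodable α] {c : α → Prop} [DecidablePred c]
    (hc : PrimrecPred c) {g h : α → ℝ} (hg : ComputableReals g) (hh : ComputableReals h) :
    ComputableReals fun a => if c a then g a else h a := by
  simpa [Bool.cond_decide] using ComputableReals.cond hc.decide.to_comp hg hh

/-- The parameter in `α` gives uniformity, needed for infinite sums of strategies and for Riemann
sums over grid points. -/
theorem computableReals_treeProb {α : Type} [Primcodable α] {s : α × List (Fin 2) → ℝ}
    (hs : ComputableReals s) (h0 : ∀ p, 0 ≤ s p) (h1 : ∀ p, s p ≤ 1) :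
    ComputableReals fun p : α × List (Fin 2) => treeProb (fun τ => s (p.1, τ)) p.2 := by
  have hbit : Primrec fun r : (α × List (Fin 2)) × ℕ => r.1.2.getD r.2 0 :=
    (Primrec.list_getD 0).comp (Primrec.snd.comp Primrec.fst) Primrec.snd
  have hs' : ComputableReals fun r : (α × List (Fin 2)) × ℕ => s (r.1.1, r.1.2.take r.2) :=
    hs.comp ((Computable.fst.comp Computable.fst).pair (Primrec.list_take.to_comp.comp
      Computable.snd (Computable.snd.comp Computable.fst)))
  have h1' : ComputableReals fun _ : (α × List (Fin 2)) × ℕ => (1 : ℝ) := by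
    simpa using ComputableReals.const_div_two_pow 1 0
  refine ComputableReals.prod_range
    (g := fun r : (α × List (Fin 2)) × ℕ => if r.1.2.getD r.2 0 = 1 then s (r.1.1, r.1.2.take r.2)
      else 1 - s (r.1.1, r.1.2.take r.2))
    (ComputableReals.ite (Primrec.eq.comp hbit (Primrec.const 1)) hs' (h1'.sub hs')) ?_ ?_
    (Computable.list_length.comp Computable.snd)
  · intro r
    split_ifs
    · exact h0 _
    · exact sub_nonneg.2 (h1 _)
  · intro r
    split_ifs
    · exact h1 _
    · exact sub_le_self _ (h0 _)

theorem computableReals_treeProb_const {s : List (Fin 2) → ℝ}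
    (hs : ComputableReals s) (h0 : ∀ p, 0 ≤ s p) (h1 : ∀ p, s p ≤ 1) :
    ComputableReals (treeProb s) :=
  (computableReals_treeProb (α := Unit) (hs.comp Computable.snd) (fun _ => h0 _)
    (fun _ => h1 _)).comp ((Computable.const ()).pair Computable.id)

/-! ### Regularities of computably random sequences -/

theorem SeqComputablyRandom.bounded {Z : ℕ → Fin 2} (hZ : SeqComputablyRandom Z)
    {M : List (Fin 2) → ℝ} (hM : IsMartingale M) (hc : ComputableReals M) :
    ∃ c, ∀ m, M (initSeg Z m) ≤ c := by
  have := hZ M hM hc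
  simpa [Succeeds, initSeg] using this

/-- If a decidable condition on prefixes holds infinitely often along a computably random
sequence, then infinitely often it holds and the next bit is a prescribed one. -/
theorem SeqComputablyRandom.frequently_and_eq {Z : ℕ → Fin 2} (hZ : SeqComputablyRandom Z)
    {P : List (Fin 2) → Prop} (hP : PrimrecPred P) (c : Fin 2)
    (h : ∀ N, ∃ k ≥ N, P (initSeg Z k)) : ∀ N, ∃ k ≥ N, P (initSeg Z k) ∧ Z k = c := by
  classical
  intro N
  by_contra! hN
  -- Whenever `P` holds from length `N` on, everything is bet on the next bit not being `c`; by
  -- assumption each such bet wins and doubles the capital.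
  set s : List (Fin 2) → ℝ := fun τ =>
    if P τ ∧ N ≤ τ.length then (if c = 1 then 0 else 1) else 1 / 2 with hs
  have h0 : ∀ τ, 0 ≤ s τ := fun τ => by simp only [hs]; split_ifs <;> norm_num
  have h1 : ∀ τ, s τ ≤ 1 := fun τ => by simp only [hs]; split_ifs <;> norm_num
  have hsc : ComputableReals s := by
    refine ComputableReals.ite (hP.and (Primrec.nat_le.comp (Primrec.const N)
      Primrec.list_length)) ?_ ?_
    · split_ifs
      · simpa using ComputableReals.const_div_two_pow (α := List (Fin 2)) 0 0
      · simpa using ComputableReals.const_div_two_pow (α := List (Fin 2)) 1 0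
    · simpa using ComputableReals.const_div_two_pow (α := List (Fin 2)) 1 1
  obtain ⟨C, hC⟩ := hZ.bounded (isMartingale_treeProb h0 h1)
    ((computableReals_treeProb_const hsc h0 h1).two_pow_mul Computable.list_length)
  simp only [length_initSeg] at hC
  have hpos : ∀ m, 2 ^ m * treeProb s (initSeg Z m) ≤
      2 ^ (m + 1) * treeProb s (initSeg Z (m + 1)) ∧ (P (initSeg Z m) → N ≤ m →
      2 ^ (m + 1) * treeProb s (initSeg Z (m + 1)) = 2 * (2 ^ m * treeProb s (initSeg Z m))) := by
    intro m
    have hnn : 0 ≤ 2 ^ m * treeProb s (initSeg Z m) :=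
      mul_nonneg (by positivity) (treeProb_nonneg h0 h1 _)
    rw [initSeg_succ, treeProb_concat, pow_succ]
    by_cases hm : P (initSeg Z m) ∧ N ≤ m
    · have hZm := hN m hm.2 hm.1
      have e : (if Z m = 1 then s (initSeg Z m) else 1 - s (initSeg Z m)) = 1 := by
        simp only [hs, length_initSeg, hm, and_self, if_true]
        rcases Fin.exists_fin_two.1 ⟨c, rfl⟩ with rfl | rfl <;>
          rcases Fin.exists_fin_two.1 ⟨Z m, rfl⟩ with h | h <;> simp_all
      rw [e]
      constructor
      · linarith
      · intros; ring
    · have e : (if Z m = 1 then s (initSeg Z m) else 1 - s (initSeg Z m)) = 1 / 2 := by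
        simp only [hs, length_initSeg, hm, if_false]
        split_ifs <;> norm_num
      rw [e]
      refine ⟨le_of_eq (by ring), fun h1 h2 => absurd ⟨h1, h2⟩ hm⟩
  have hmono : Monotone fun m => 2 ^ m * treeProb s (initSeg Z m) :=
    monotone_nat_of_le_succ fun m => (hpos m).1
  have hgrow : ∀ j : ℕ, ∃ m, 2 ^ j ≤ 2 ^ m * treeProb s (initSeg Z m) := by
    intro j
    induction j with
    | zero => exact ⟨0, by simp [initSeg, treeProb]⟩
    | succ j ih =>
      obtain ⟨m, hm⟩ := ih
      obtain ⟨k, hk, hPk⟩ := h (max m N)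
      refine ⟨k + 1, ?_⟩
      rw [(hpos k).2 hPk (le_trans (le_max_right _ _) hk), pow_succ]
      have := hmono (le_trans (le_max_left _ _) hk)
      dsimp only at this
      linarith
  obtain ⟨j, hj⟩ := pow_unbounded_of_one_lt C (one_lt_two : (1 : ℝ) < 2)
  obtain ⟨m, hm⟩ := hgrow j
  exact absurd (hC m) (not_le.2 (hj.trans_le hm))

theorem computableReals_tsum {α : Type} [Primcodable α] {t : α × ℕ → ℝ} (ht : ComputableReals t)
    (h0 : ∀ a, 0 ≤ t a) (h1 : ∀ a j, t (a, j) ≤ (1 / 2) ^ j) :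
    ComputableReals fun a => ∑' j, t (a, j) := by
  have hsum : ∀ a, Summable fun j => t (a, j) := fun a =>
    Summable.of_nonneg_of_le (fun j => h0 _) (h1 a) summable_geometric_two
  refine ComputableReals.of_tendsto
    (h := fun p : α × ℕ => ∑ j ∈ Finset.range (p.2 + 1), t (p.1, j)) ?_ fun a k => ?_
  · exact ComputableReals.sum_range (g := fun r : (α × ℕ) × ℕ => t (r.1.1, r.2))
      (ht.comp ((Computable.fst.comp Computable.fst).pair Computable.snd))
      (Computable.succ.comp Computable.snd)
  · dsimp only
    rw [← (hsum a).sum_add_tsum_nat_add (k + 1), add_sub_cancel_left,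
      abs_of_nonneg (tsum_nonneg fun _ => h0 _)]
    have hg : Summable fun j : ℕ => (1 / 2 : ℝ) ^ (j + (k + 1)) :=
      (summable_nat_add_iff (k + 1)).2 summable_geometric_two
    refine (Summable.tsum_le_tsum (fun j => h1 a _) ((summable_nat_add_iff (k + 1)).2 (hsum a))
      hg).trans ?_
    simp_rw [pow_add _ _ (k + 1)]
    rw [tsum_mul_right, tsum_geometric_two, pow_succ]
    linarith

/-- The betting rule which bets everything on the bits at the positions `k + n, k + 2n, …, k + kn`
being different from the bit at position `k`. -/
noncomputable def runBet (n k : ℕ) (τ : List (Fin 2)) : ℝ :=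
  if k < τ.length ∧ τ.length ≤ k + k * n ∧ τ.length % n = k % n then
    (if τ.getD k 0 = 1 then 0 else 1) else 1 / 2

theorem runBet_nonneg (n k : ℕ) (τ : List (Fin 2)) : 0 ≤ runBet n k τ := by
  unfold runBet; split_ifs <;> norm_num

theorem runBet_le_one (n k : ℕ) (τ : List (Fin 2)) : runBet n k τ ≤ 1 := by
  unfold runBet; split_ifs <;> norm_num

theorem computableReals_runBet (n : ℕ) :
    ComputableReals fun p : ℕ × List (Fin 2) => runBet n p.1 p.2 := by
  have hl : Primrec fun p : ℕ × List (Fin 2) => p.2.length := Primrec.list_length.comp Primrec.snd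
  unfold runBet
  refine ComputableReals.ite ?_ (ComputableReals.ite ?_ ?_ ?_) ?_
  · refine (Primrec.nat_lt.comp Primrec.fst hl).and ((Primrec.nat_le.comp hl ?_).and ?_)
    · exact Primrec.nat_add.comp Primrec.fst (Primrec.nat_mul.comp Primrec.fst (Primrec.const n))
    · exact Primrec.eq.comp (Primrec.nat_mod.comp hl (Primrec.const n))
        (Primrec.nat_mod.comp Primrec.fst (Primrec.const n))
  · exact Primrec.eq.comp ((Primrec.list_getD 0).comp Primrec.snd Primrec.fst) (Primrec.const 1)
  · simpa using ComputableReals.const_div_two_pow (α := ℕ × List (Fin 2)) 0 0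
  · simpa using ComputableReals.const_div_two_pow (α := ℕ × List (Fin 2)) 1 0
  · simpa using ComputableReals.const_div_two_pow (α := ℕ × List (Fin 2)) 1 1

/-- The capital doubles at each of the `k` positions in `S` and is unchanged elsewhere. -/
theorem two_pow_le_treeProb_runBet {n : ℕ} (hn : 0 < n) {k m : ℕ} {Z : ℕ → Fin 2}
    (hZ : ∀ t, 1 ≤ t → t ≤ k → Z (k + t * n) ≠ Z k) (hm : k + k * n < m) :
    2 ^ k ≤ 2 ^ m * treeProb (runBet n k) (initSeg Z m) := by
  set S : Finset ℕ := (Finset.range k).image fun t => k + (t + 1) * n with hS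
  have hcard : S.card = k := by
    rw [hS, Finset.card_image_of_injective _ fun a b h => ?_, Finset.card_range]
    simpa [hn.ne'] using h
  have hsub : S ⊆ Finset.range m := fun p hp => by
    obtain ⟨t, ht, rfl⟩ := Finset.mem_image.1 hp
    have : (t + 1) * n ≤ k * n := Nat.mul_le_mul_right _ (Finset.mem_range.1 ht)
    exact Finset.mem_range.2 (by omega)
  have hle : ∀ p ∈ Finset.range m, (if p ∈ S then (2 : ℝ) else 1) ≤
      2 * if Z p = 1 then runBet n k (initSeg Z p) else 1 - runBet n k (initSeg Z p) := by
    intro p _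
    by_cases hp : k < p ∧ p ≤ k + k * n ∧ p % n = k % n
    · have hne : Z p ≠ Z k := by
        obtain ⟨d, rfl⟩ := Nat.exists_eq_add_of_lt hp.1
        have hd : n ∣ d + 1 := by
          have := (Nat.modEq_iff_dvd' (show k ≤ k + d + 1 by omega)).1 hp.2.2.symm
          rwa [show k + d + 1 - k = d + 1 by omega] at this
        obtain ⟨t, ht⟩ := hd
        have h1 : 1 ≤ t := Nat.pos_of_ne_zero fun h => by simp [h] at ht
        have h2 : t ≤ k := by
          have : n * t ≤ n * k := by have := hp.2.1; rw [mul_comm n k]; omega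
          exact Nat.le_of_mul_le_mul_left this hn
        have := hZ t h1 h2
        rwa [mul_comm, ← ht] at this
      have hr : runBet n k (initSeg Z p) = if Z k = 1 then 0 else 1 := by
        rw [runBet, length_initSeg, if_pos hp, getD_initSeg Z hp.1]
      have e : (if Z p = 1 then runBet n k (initSeg Z p) else 1 - runBet n k (initSeg Z p)) = 1 := by
        rw [hr]
        rcases Fin.exists_fin_two.1 ⟨Z k, rfl⟩ with h | h <;>
          rcases Fin.exists_fin_two.1 ⟨Z p, rfl⟩ with h' | h' <;> simp_all
      rw [e]
      split_ifs <;> norm_num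
    · have hpS : p ∉ S := fun h => by
        obtain ⟨t, ht, rfl⟩ := Finset.mem_image.1 h
        have h1 : (t + 1) * n ≤ k * n := Nat.mul_le_mul_right _ (Finset.mem_range.1 ht)
        have h2 : 0 < (t + 1) * n := by positivity
        exact hp ⟨by omega, by omega, by simp⟩
      have hr : runBet n k (initSeg Z p) = 1 / 2 := by
        rw [runBet, length_initSeg, if_neg hp]
      rw [if_neg hpS, hr]
      split_ifs <;> norm_num
  have := Finset.prod_le_prod (fun p _ => by split_ifs <;> norm_num) hle
  rw [Finset.prod_mul_distrib, Finset.prod_const, Finset.card_range, ← treeProb_initSeg,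
    Finset.prod_ite_mem, Finset.inter_eq_right.2 hsub, Finset.prod_const, hcard] at this
  exact this

/-- Along a computably random sequence, only finitely many positions `k` are followed by `k`
bits at distance `n` from each other that differ from the bit at `k`. -/
theorem SeqComputablyRandom.eventually_not_run {Z : ℕ → Fin 2} (hZ : SeqComputablyRandom Z)
    {n : ℕ} (hn : 0 < n) :
    ∃ B, ∀ k ≥ B, ∃ t, 1 ≤ t ∧ t ≤ k ∧ Z (k + t * n) = Z k := by
  -- The strategy for `k` starts with capital 2^(-k), which makes the sum computable. It wins a
  -- factor 2^k if `k` is followed by a run, so each such `k` eventually contributes at least 1.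
  set t : List (Fin 2) × ℕ → ℝ := fun p => (1 / 2) ^ p.2 * treeProb (runBet n p.2) p.1 with ht
  have htc : ComputableReals t := by
    have := ((computableReals_treeProb (computableReals_runBet n) (fun _ => runBet_nonneg _ _ _)
      (fun _ => runBet_le_one _ _ _)).comp
      (Computable.snd.pair Computable.fst : Computable fun p : List (Fin 2) × ℕ => (p.2, p.1))
      ).div_two_pow Computable.snd
    simpa [ht, div_eq_inv_mul] using this
  have h0 : ∀ p, 0 ≤ t p := fun p =>
    mul_nonneg (by positivity) (treeProb_nonneg (runBet_nonneg _ _) (runBet_le_one _ _) _)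
  have h1 : ∀ σ j, t (σ, j) ≤ (1 / 2) ^ j := fun σ j =>
    mul_le_of_le_one_right (by positivity) (treeProb_le_one (runBet_nonneg _ _) (runBet_le_one _ _) _)
  have hsum : ∀ σ, Summable fun j => t (σ, j) := fun a =>
    Summable.of_nonneg_of_le (fun j => h0 _) (h1 a) summable_geometric_two
  have hM : IsMartingale fun σ => 2 ^ σ.length * ∑' j, t (σ, j) := by
    refine ⟨fun σ => mul_nonneg (by positivity) (tsum_nonneg fun _ => h0 _), fun σ => ?_⟩
    simp only [List.length_append, List.length_singleton]
    rw [← mul_add, ← (hsum _).tsum_add (hsum _), pow_succ]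
    simp only [ht, ← mul_add, treeProb_add]
    ring
  obtain ⟨C, hC⟩ := hZ.bounded hM ((computableReals_tsum htc h0 h1).two_pow_mul
    Computable.list_length)
  simp only [length_initSeg] at hC
  by_contra! hB
  have hinf : {k | ∀ t, 1 ≤ t → t ≤ k → Z (k + t * n) ≠ Z k}.Infinite :=
    Set.infinite_of_not_bddAbove fun ⟨b, hb⟩ => by
      obtain ⟨k, hk, hk'⟩ := hB (b + 1)
      have := hb hk'
      omega
  obtain ⟨N, hN⟩ := exists_nat_gt C
  obtain ⟨S, hS, hcard⟩ := hinf.exists_subset_card_eq N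
  obtain ⟨m, hm⟩ : ∃ m, ∀ k ∈ S, k + k * n < m := by
    refine ⟨S.sup (fun k => k + k * n) + 1, fun k hk => Nat.lt_succ_of_le ?_⟩
    exact Finset.le_sup (f := fun k => k + k * n) hk
  have := hC m
  have hle : (N : ℝ) ≤ 2 ^ m * ∑' j, t (initSeg Z m, j) := by
    calc (N : ℝ) = ∑ k ∈ S, (1 : ℝ) := by simp [hcard]
      _ ≤ ∑ k ∈ S, 2 ^ m * t (initSeg Z m, k) := by
        refine Finset.sum_le_sum fun k hk => ?_
        have := two_pow_le_treeProb_runBet hn (hS hk) (hm k hk)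
        simp only [ht]
        rw [mul_left_comm, one_div, inv_pow, ← div_eq_inv_mul, one_le_div (by positivity)]
        exact this
      _ = 2 ^ m * ∑ k ∈ S, t (initSeg Z m, k) := by rw [Finset.mul_sum]
      _ ≤ _ := by
        gcongr
        exact (hsum _).sum_le_tsum _ fun _ _ => h0 _
  linarith

theorem take_initSeg_succ (Z : ℕ → Fin 2) (m : ℕ) : (initSeg Z (m + 1)).take m = initSeg Z m := by
  rw [initSeg_succ, List.take_append_of_le_length (by simp), List.take_of_length_le (by simp)]

/-- Every finite pattern occurs in a computably random sequence at infinitely many multiples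
of `n`. -/
theorem SeqComputablyRandom.frequently_pattern {Z : ℕ → Fin 2} (hZ : SeqComputablyRandom Z)
    {n : ℕ} (hn : 0 < n) (pat : ℕ → Fin 2) (r N : ℕ) :
    ∃ k ≥ N, ∀ i < r, Z (k * n + i) = pat i := by
  -- For the induction, the occurrence of the pattern must be recognised by a primitive recursive
  -- property of the prefix ending with it; its next bit is then supplied by
  -- `SeqComputablyRandom.frequently_and_eq`.
  have key : ∃ P : List (Fin 2) → Prop, PrimrecPred P ∧ (∀ N, ∃ k ≥ N, P (initSeg Z k)) ∧
      ∀ k, P (initSeg Z k) → ∃ a, k = a * n + r ∧ ∀ i < r, Z (a * n + i) = pat i := by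
    induction r with
    | zero =>
      refine ⟨fun τ => τ.length % n = 0, Primrec.eq.comp (Primrec.nat_mod.comp Primrec.list_length
        (Primrec.const n)) (Primrec.const 0), fun N => ⟨N * n, Nat.le_mul_of_pos_right _ hn, ?_⟩,
        fun k hk => ?_⟩
      · simp
      · dsimp only at hk
        rw [length_initSeg] at hk
        exact ⟨k / n, (Nat.div_mul_cancel (Nat.dvd_of_mod_eq_zero hk)).symm, by simp⟩
    | succ r ih =>
      obtain ⟨P, hP, hfreq, hpat⟩ := ih
      have hpred : Primrec fun τ : List (Fin 2) => τ.length - 1 :=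
        Primrec.nat_sub.comp Primrec.list_length (Primrec.const 1)
      refine ⟨fun τ => (P (τ.take (τ.length - 1)) ∧ τ.getD (τ.length - 1) 0 = pat r) ∧
        0 < τ.length, ?_, fun N => ?_, fun k hk => ?_⟩
      · exact ((hP.comp (Primrec.list_take.comp hpred Primrec.id)).and
          (Primrec.eq.comp ((Primrec.list_getD 0).comp Primrec.id hpred) (Primrec.const _))).and
          (Primrec.nat_lt.comp (Primrec.const 0) Primrec.list_length)
      · obtain ⟨k, hk, hPk, hZk⟩ := hZ.frequently_and_eq hP (pat r) hfreq N
        refine ⟨k + 1, by omega, ⟨?_, ?_⟩, by simp⟩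
        · rwa [length_initSeg, Nat.add_sub_cancel, take_initSeg_succ]
        · rwa [length_initSeg, Nat.add_sub_cancel, getD_initSeg Z (Nat.lt_succ_self k)]
      · dsimp only at hk
        rw [length_initSeg] at hk
        obtain ⟨k, rfl⟩ : ∃ j, k = j + 1 := ⟨k - 1, by omega⟩
        rw [Nat.add_sub_cancel, take_initSeg_succ, getD_initSeg Z (Nat.lt_succ_self k)] at hk
        obtain ⟨⟨hk1, hk2⟩, -⟩ := hk
        obtain ⟨a, rfl, ha⟩ := hpat k hk1
        refine ⟨a, by ring, fun i hi => ?_⟩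
        rcases Nat.lt_succ_iff_lt_or_eq.1 hi with h | rfl
        · exact ha i h
        · exact hk2
  obtain ⟨P, -, hfreq, hpat⟩ := key
  obtain ⟨k, hk, hPk⟩ := hfreq (N * n + r)
  obtain ⟨a, rfl, ha⟩ := hpat k hPk
  exact ⟨a, Nat.le_of_mul_le_mul_right (by omega : N * n ≤ a * n) hn, ha⟩

/-! ### Binary digits and closeness to a dyadic midpoint -/

section Digits

/-- The dyadic number with binary digits `d 0, …, d (m - 1)`. -/
noncomputable def digitSum (d : ℕ → Fin 2) (m : ℕ) : ℝ :=
  ∑ t ∈ Finset.range m, ((d t : ℕ) : ℝ) / 2 ^ (t + 1)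

theorem digitSum_succ_zero {d : ℕ → Fin 2} {m : ℕ} (h : d m = 0) :
    digitSum d (m + 1) = digitSum d m := by
  simp [digitSum, Finset.sum_range_succ, h]

theorem digitSum_succ_one {d : ℕ → Fin 2} {m : ℕ} (h : d m = 1) :
    digitSum d (m + 1) = digitSum d m + 1 / 2 ^ (m + 1) := by
  simp [digitSum, Finset.sum_range_succ, h]

theorem digitSum_mono (d : ℕ → Fin 2) : Monotone (digitSum d) :=
  monotone_nat_of_le_succ fun m => by
    rw [digitSum, digitSum, Finset.sum_range_succ]
    exact le_add_of_nonneg_right (by positivity)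

theorem digitSum_add_antitone (d : ℕ → Fin 2) : Antitone fun m => digitSum d m + 1 / 2 ^ m :=
  antitone_nat_of_succ_le fun m => by
    have e : (1 : ℝ) / 2 ^ m = 1 / 2 ^ (m + 1) + 1 / 2 ^ (m + 1) := by rw [pow_succ]; field_simp; ring
    rcases Fin.exists_fin_two.1 ⟨d m, rfl⟩ with h | h
    · rw [digitSum_succ_zero h, e]
      have : (0 : ℝ) ≤ 1 / 2 ^ (m + 1) := by positivity
      linarith
    · rw [digitSum_succ_one h, e]
      linarith

/-- `d` is a sequence of binary digits of `v`. -/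
def IsDigits (d : ℕ → Fin 2) (v : ℝ) : Prop :=
  ∀ m, digitSum d m ≤ v ∧ v ≤ digitSum d m + 1 / 2 ^ m

theorem isDigits_digits {v : ℝ} (hv : v ∈ Set.Ico (0 : ℝ) 1) : IsDigits (Real.digits v 2) v := by
  intro m
  have e : digitSum (Real.digits v 2) m =
      ∑ i ∈ Finset.range m, Real.ofDigitsTerm (Real.digits v 2) i := by
    simp [digitSum, Real.ofDigitsTerm, div_eq_mul_inv]
  rw [e]
  have h1 := Real.sum_ofDigitsTerm_digits_le (b := 2) hv m
  have h2 := Real.le_sum_ofDigitsTerm_digits (b := 2) hv m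
  refine ⟨h1, ?_⟩
  rw [inv_pow] at h2
  rw [one_div]
  push_cast at h2
  linarith

/-- Close to the midpoint the expansion continues as 0111… or 1000…. A repetition of digit `j` at
place `j + t` keeps `v` at least 2^(-(j+t+1)) away. -/
theorem IsDigits.ne_of_abs_sub_lt {d : ℕ → Fin 2} {v : ℝ} (h : IsDigits d v) {j g t : ℕ}
    (hv : |v - (digitSum d j + 1 / 2 ^ (j + 1))| < 1 / 2 ^ (j + 1 + g)) (h1 : 1 ≤ t) (h2 : t ≤ g) :
    d (j + t) ≠ d j := by
  have hp : (1 : ℝ) / 2 ^ (j + 1 + g) ≤ 1 / 2 ^ (j + t + 1) :=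
    one_div_le_one_div_of_le (by positivity) (pow_le_pow_right₀ (by norm_num) (by omega))
  rw [abs_lt] at hv
  intro he
  rcases Fin.exists_fin_two.1 ⟨d j, rfl⟩ with hj | hj
  · have e1 := digitSum_succ_zero hj
    have e2 := digitSum_succ_zero (he.trans hj)
    have h3 := (h (j + t + 1)).2
    have h4 := digitSum_add_antitone d (show j + 1 ≤ j + t by omega)
    have e : (1 : ℝ) / 2 ^ (j + t) = 1 / 2 ^ (j + t + 1) + 1 / 2 ^ (j + t + 1) := by
      rw [pow_succ]; field_simp; ring
    dsimp only at h4
    linarith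
  · have e1 := digitSum_succ_one hj
    have e2 := digitSum_succ_one (he.trans hj)
    have h3 := (h (j + t + 1)).1
    have h4 := digitSum_mono d (show j + 1 ≤ j + t by omega)
    linarith

end Digits

/-! ### Soft binary expansions -/

section SoftBet

variable {n : ℕ}

/-- The coordinate `|τ| % n` of the centre of the dyadic box of `τ`. -/
noncomputable def boxMid (n : ℕ) (τ : List (Fin 2)) : ℝ :=
  digitSum (fun t => τ.getD (t * n + τ.length % n) 0) (τ.length / n) + 1 / 2 ^ (τ.length / n + 1)

theorem boxMid_initSeg [NeZero n] (Z : ℕ → Fin 2) (p : ℕ) : boxMid n (initSeg Z p) =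
    digitSum (fun t => Z (t * n + p % n)) (p / n) + 1 / 2 ^ (p / n + 1) := by
  unfold boxMid
  rw [length_initSeg]
  congr 1
  refine Finset.sum_congr rfl fun t ht => ?_
  have ht' : t + 1 ≤ p / n := Finset.mem_range.1 ht
  dsimp only
  rw [getD_initSeg]
  have h1 := Nat.mul_le_mul_right n ht'
  have h2 := Nat.div_add_mod' p n
  have h3 : 0 < n := Nat.pos_of_neZero n
  rw [add_mul] at h1
  omega

theorem computableReals_boxMid : ComputableReals (boxMid n) := by
  have hl : Primrec (fun τ : List (Fin 2) => τ.length) := Primrec.list_length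
  have hq : Primrec (fun τ : List (Fin 2) => τ.length / n) :=
    Primrec.nat_div.comp hl (Primrec.const n)
  refine ComputableReals.add ?_ ?_
  · refine ComputableReals.sum_range (g := fun r : List (Fin 2) × ℕ =>
      ((r.1.getD (r.2 * n + r.1.length % n) 0 : ℕ) : ℝ) / 2 ^ (r.2 + 1)) ?_ hq.to_comp
    refine (ComputableReals.natCast ?_).div_two_pow (Computable.succ.comp Computable.snd)
    refine (Primrec.fin_val.comp ((Primrec.list_getD 0).comp Primrec.fst ?_)).to_comp
    exact Primrec.nat_add.comp (Primrec.nat_mul.comp Primrec.snd (Primrec.const n))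
      (Primrec.nat_mod.comp (hl.comp Primrec.fst) (Primrec.const n))
  · simpa using ComputableReals.inv_two_pow (Primrec.succ.comp hq).to_comp

/-- Merges the `n` algorithms into one, so that the coordinate may itself be computed from the
string. -/
theorem ComputableReals.finite_family {α : Type} [Primcodable α] {g : α → Fin n → ℝ}
    (hg : ∀ i, ComputableReals fun a => g a i) :
    ComputableReals fun p : α × Fin n => g p.1 p.2 := by
  choose q hq H using hg
  refine ⟨fun p k => (List.Vector.ofFn fun i => q i p.1 k).get p.2, ?_, fun p k => ?_⟩
  · refine Computable.vector_get.comp (Computable.vector_ofFn fun i => ?_)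
      (Computable.snd.comp Computable.fst)
    exact (hq i).comp (Computable.fst.comp Computable.fst) Computable.snd
  · simpa using H p.2 p.1 k

variable [NeZero n]

/-- A continuous version of the rule that bets everything on the half of the box of `τ` which
contains `u`. -/
noncomputable def softBet (u : Fin n → ℝ) (τ : List (Fin 2)) : ℝ :=
  clamp (2 ^ (2 * τ.length + 1) * (u (Fin.ofNat n τ.length) - boxMid n τ) + 1 / 2)

theorem softBet_nonneg (u : Fin n → ℝ) (τ : List (Fin 2)) : 0 ≤ softBet u τ := clamp_nonneg _

theorem softBet_le_one (u : Fin n → ℝ) (τ : List (Fin 2)) : softBet u τ ≤ 1 := clamp_le_one _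

theorem computableReals_softBet {α : Type} [Primcodable α] {g : α → Fin n → ℝ}
    (hg : ∀ i, ComputableReals fun a => g a i) :
    ComputableReals fun p : α × List (Fin 2) => softBet (g p.1) p.2 := by
  have hl : Primrec fun p : α × List (Fin 2) => p.2.length := Primrec.list_length.comp Primrec.snd
  have hfin : Computable fun p : α × List (Fin 2) => (p.1, Fin.ofNat n p.2.length) :=
    Computable.fst.pair (Primrec.fin_val_iff.1 (Primrec.nat_mod.comp hl (Primrec.const n))).to_comp
  have hhalf : ComputableReals fun _ : α × List (Fin 2) => (1 / 2 : ℝ) := by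
    simpa using ComputableReals.const_div_two_pow (α := α × List (Fin 2)) 1 1
  refine ComputableReals.clamp (ComputableReals.add (ComputableReals.two_pow_mul
    (ComputableReals.sub ((ComputableReals.finite_family hg).comp hfin)
      (computableReals_boxMid.comp Computable.snd)) ?_) hhalf)
  exact (Primrec.nat_double_succ.comp hl).to_comp

/-- Each factor has slope at most 2^(2|σ|+1), as clamping does not increase distances. This
continuity is the purpose of softening the bets. -/
theorem abs_treeProb_softBet_sub_le (σ : List (Fin 2)) {u v : Fin n → ℝ} {δ : ℝ}
    (h : ∀ i, |u i - v i| ≤ δ) :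
    |treeProb (softBet u) σ - treeProb (softBet v) σ| ≤
      σ.length * (2 ^ (2 * σ.length + 1) * δ) := by
  have hδ : 0 ≤ δ := (abs_nonneg _).trans (h 0)
  have hbd : ∀ (u : Fin n → ℝ) (p : ℕ), |if σ.getD p 0 = 1 then softBet u (σ.take p)
      else 1 - softBet u (σ.take p)| ≤ 1 := by
    intro u p
    have h0 := softBet_nonneg u (σ.take p)
    have h1 := softBet_le_one u (σ.take p)
    split_ifs <;> rw [abs_le] <;> constructor <;> linarith
  refine (abs_prod_sub_prod_le _ _ _ (fun p _ => hbd u p) (fun p _ => hbd v p)).trans ?_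
  refine (Finset.sum_le_card_nsmul _ _ (2 ^ (2 * σ.length + 1) * δ) fun p hp => ?_).trans
    (by rw [Finset.card_range, nsmul_eq_mul])
  have key : |softBet u (σ.take p) - softBet v (σ.take p)| ≤ 2 ^ (2 * σ.length + 1) * δ := by
    refine (abs_clamp_sub_clamp_le _ _).trans ?_
    rw [add_sub_add_right_eq_sub, ← mul_sub, sub_sub_sub_cancel_right, abs_mul,
      abs_of_pos (by positivity : (0 : ℝ) < 2 ^ (2 * (σ.take p).length + 1))]
    have hlen : (σ.take p).length ≤ σ.length := List.length_take_le' _ _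
    gcongr
    · norm_num
    · exact h _
  split_ifs
  · exact key
  · rwa [sub_sub_sub_cancel_left, abs_sub_comm]

/-- If `v` is well inside its dyadic cube of side `2 ^ (-k)`, then all points near `v` have a
substantial share in this cube. -/
theorem le_treeProb_softBet {Z : ℕ → Fin 2} {v u : Fin n → ℝ} {B k : ℕ}
    (hv : ∀ i : Fin n, IsDigits (fun t => Z (t * n + i)) (v i))
    (hB : ∀ p ≥ B, ∃ t, 1 ≤ t ∧ t ≤ p ∧ Z (p + t * n) = Z p)
    (hk : ∀ i < n, Z (k * n + i) = 0 ∧ Z ((k + 1) * n + i) = 1)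
    (hu : ∀ i, |u i - v i| ≤ 1 / 2 ^ (k + 3)) :
    (1 / 2) ^ B ≤ treeProb (softBet u) (initSeg Z (k * n)) := by
  have hn : 0 < n := Nat.pos_of_neZero n
  -- The soft bet favours the correct bit at every stage, and is fully saturated from stage `B` on;
  -- only the first `B` factors can be lost, each at most by 1/2.
  have hfac : ∀ p ∈ Finset.range (k * n), (if p < B then (1 / 2 : ℝ) else 1) ≤
      if Z p = 1 then softBet u (initSeg Z p) else 1 - softBet u (initSeg Z p) := by
    intro p hp
    have hpk : p < k * n := Finset.mem_range.1 hp
    set i : Fin n := Fin.ofNat n p with hi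
    have hiv : (i : ℕ) = p % n := rfl
    set d : ℕ → Fin 2 := fun t => Z (t * n + i) with hd
    set j := p / n with hj
    have hpj : p = j * n + i := by rw [hiv]; exact (Nat.div_add_mod' p n).symm
    have hjk : j < k := (Nat.div_lt_iff_lt_mul hn).2 hpk
    have hdj : d j = Z p := by simp only [hd]; rw [← hpj]
    have hdi := hv i
    set μ : ℝ := digitSum d j + 1 / 2 ^ (j + 1) with hμ
    have hmid : boxMid n (initSeg Z p) = μ := boxMid_initSeg Z p
    have hsoft : softBet u (initSeg Z p) = clamp (2 ^ (2 * p + 1) * (u i - μ) + 1 / 2) := by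
      rw [softBet, length_initSeg, hmid]
    have hd0 : d k = 0 := (hk i i.2).1
    have hd1 : d (k + 1) = 1 := (hk i i.2).2
    have e0 := digitSum_succ_zero hd0
    have e1 := digitSum_succ_one hd1
    have hlow := (hdi (k + 1 + 1)).1
    have hupp := (hdi (k + 1)).2
    have hui := abs_le.1 (hu i)
    have p1 : (1 : ℝ) / 2 ^ (k + 1 + 1) = 2 * (1 / 2 ^ (k + 3)) := by
      rw [pow_add _ k 3, pow_succ, pow_succ]; field_simp
    have p2 : (1 : ℝ) / 2 ^ (k + 1) = 4 * (1 / 2 ^ (k + 3)) := by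
      rw [pow_add _ k 3, pow_succ]; field_simp; norm_num
    have p3 : (1 : ℝ) / 2 ^ k = 8 * (1 / 2 ^ (k + 3)) := by
      rw [pow_add _ k 3]; field_simp; norm_num
    -- Otherwise digit `j` would be followed by `p` opposite digits in its coordinate, contrary to
    -- `hB`.
    have hfar : B ≤ p → 1 / 2 ^ (2 * p + 1) ≤ |v i - μ| := by
      intro hBp
      by_contra! hlt
      obtain ⟨t, ht1, ht2, ht3⟩ := hB p hBp
      have hle : (1 : ℝ) / 2 ^ (2 * p + 1) ≤ 1 / 2 ^ (j + 1 + p) :=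
        one_div_le_one_div_of_le (by positivity) (pow_le_pow_right₀ (by norm_num) (by
          have : j ≤ p := Nat.div_le_self _ _
          omega))
      refine IsDigits.ne_of_abs_sub_lt (g := p) hdi (hlt.trans_le hle) ht1 ht2 ?_
      rw [← hpj, ← ht3]
      congr 1
      conv_rhs => rw [hpj]
      ring
    have hpow : (2 : ℝ) ^ (2 * p + 1) * (1 / 2 ^ (2 * p + 1)) = 1 := by field_simp
    have hP : (0 : ℝ) < 2 ^ (2 * p + 1) := by positivity
    have hpos : (0 : ℝ) < 1 / 2 ^ (k + 3) := by positivity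
    rcases Fin.exists_fin_two.1 ⟨Z p, rfl⟩ with h | h
    · have hup : digitSum d k + 1 / 2 ^ k ≤ μ := by
        have := digitSum_add_antitone d (show j + 1 ≤ k by omega)
        dsimp only at this
        rwa [digitSum_succ_zero (hdj.trans h)] at this
      -- Digits 0, 1 at places `k`, `k + 1` keep `v i` away from the faces by 2 or 4 units of
      -- 2^(-(k+3)). Since `u i` is within one unit of `v i`, it retains at least half of the
      -- distance to the cut.
      have hD : 4 * (1 / 2 ^ (k + 3)) ≤ μ - v i := by linarith
      have hU : (μ - v i) / 2 ≤ μ - u i := by linarith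
      rw [if_neg (show ¬ Z p = 1 by rw [h]; decide), hsoft]
      split_ifs with hpB
      · have : clamp (2 ^ (2 * p + 1) * (u i - μ) + 1 / 2) ≤ clamp (1 / 2) := clamp_mono (by nlinarith)
        rw [clamp_of_mem (x := 1 / 2) (by norm_num) (by norm_num)] at this
        linarith
      · have h3 := hfar (not_lt.1 hpB)
        rw [abs_sub_comm, abs_of_nonneg (by linarith)] at h3
        have : clamp (2 ^ (2 * p + 1) * (u i - μ) + 1 / 2) ≤ clamp 0 := clamp_mono (by nlinarith)
        rw [clamp_of_mem le_rfl zero_le_one] at this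
        linarith
    · have hup : μ ≤ digitSum d k := by
        have := digitSum_mono d (show j + 1 ≤ k by omega)
        rwa [digitSum_succ_one (hdj.trans h)] at this
      have hD : 2 * (1 / 2 ^ (k + 3)) ≤ v i - μ := by linarith
      have hU : (v i - μ) / 2 ≤ u i - μ := by linarith
      rw [if_pos h, hsoft]
      split_ifs with hpB
      · have : clamp (1 / 2) ≤ clamp (2 ^ (2 * p + 1) * (u i - μ) + 1 / 2) := clamp_mono (by nlinarith)
        rwa [clamp_of_mem (x := 1 / 2) (by norm_num) (by norm_num)] at this
      · have h3 := hfar (not_lt.1 hpB)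
        rw [abs_of_nonneg (by linarith)] at h3
        have : clamp 1 ≤ clamp (2 ^ (2 * p + 1) * (u i - μ) + 1 / 2) := clamp_mono (by nlinarith)
        rwa [clamp_of_mem zero_le_one le_rfl] at this
  rw [treeProb_initSeg]
  refine le_trans ?_ (Finset.prod_le_prod (fun p _ => by split_ifs <;> norm_num) hfac)
  rw [← Finset.prod_filter, Finset.prod_const]
  refine pow_le_pow_of_le_one (by norm_num) (by norm_num) ?_
  calc _ ≤ (Finset.range B).card := Finset.card_le_card fun p hp => by simp_all
    _ = B := Finset.card_range B

end SoftBet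

/-! ### Riemann sums on the cube and preimages at a singular point -/

open MeasureTheory

variable {n : ℕ}

/-- The half-open unit cube. -/
def unitCube (n : ℕ) : Set (Fin n → ℝ) := Set.pi Set.univ fun _ => Set.Ico 0 1

theorem measurableSet_unitCube : MeasurableSet (unitCube n) :=
  MeasurableSet.univ_pi fun _ => measurableSet_Ico

theorem volume_unitCube : volume (unitCube n) = 1 := by
  simp [unitCube, Real.volume_pi_Ico]

/-- The points of the grid of mesh `2 ^ (-K)` in the unit cube, numbered by
`0, …, (2 ^ K) ^ n - 1`. -/
noncomputable def gridPoint (n K t : ℕ) : Fin n → ℝ :=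
  fun i => ((t / (2 ^ K) ^ (i : ℕ) % 2 ^ K : ℕ) : ℝ) / 2 ^ K

/-- The cube of side `1 / m` with lower corner `p / m`. -/
def gridCell (m : ℕ) (p : Fin n → Fin m) : Set (Fin n → ℝ) :=
  Set.pi Set.univ fun i => Set.Ico (((p i : ℕ) : ℝ) / m) ((((p i : ℕ) : ℝ) + 1) / m)

theorem measurableSet_gridCell (m : ℕ) (p : Fin n → Fin m) : MeasurableSet (gridCell m p) :=
  MeasurableSet.univ_pi fun _ => measurableSet_Ico

theorem volume_gridCell (m : ℕ) (p : Fin n → Fin m) :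
    volume.real (gridCell m p) = (1 / m) ^ n := by
  rw [Measure.real, gridCell, Real.volume_pi_Ico, ENNReal.toReal_prod]
  simp only [← sub_div, add_sub_cancel_left]
  rw [ENNReal.toReal_ofReal (by positivity)]
  simp

theorem mem_gridCell_iff {m : ℕ} (hm : 0 < m) (p : Fin n → Fin m) (x : Fin n → ℝ) :
    x ∈ gridCell m p ↔ ∀ i, ((p i : ℕ) : ℝ) ≤ m * x i ∧ m * x i < (p i : ℕ) + 1 := by
  have hm' : (0 : ℝ) < m := by exact_mod_cast hm
  simp only [gridCell, Set.mem_pi, Set.mem_univ, true_imp_iff, Set.mem_Ico]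
  refine forall_congr' fun i => ?_
  rw [div_le_iff₀' hm', lt_div_iff₀' hm']

theorem iUnion_gridCell {m : ℕ} (hm : 0 < m) : ⋃ p : Fin n → Fin m, gridCell m p = unitCube n := by
  have hm' : (0 : ℝ) < m := by exact_mod_cast hm
  ext x
  simp only [Set.mem_iUnion, mem_gridCell_iff hm]
  constructor
  · rintro ⟨p, hp⟩ i -
    have h1 : (0 : ℝ) ≤ (p i : ℕ) := by positivity
    have h2 : ((p i : ℕ) : ℝ) + 1 ≤ m := by exact_mod_cast (p i).2
    have h3 := hp i
    constructor
    · by_contra! h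
      nlinarith
    · by_contra! h
      nlinarith
  · intro hx
    have hx' : ∀ i, 0 ≤ x i ∧ x i < 1 := fun i => hx i (Set.mem_univ i)
    refine ⟨fun i => ⟨⌊(m : ℝ) * x i⌋₊, ?_⟩, fun i => ⟨?_, ?_⟩⟩
    · rw [Nat.floor_lt (mul_nonneg hm'.le (hx' i).1)]
      nlinarith [hx' i]
    · exact Nat.floor_le (mul_nonneg hm'.le (hx' i).1)
    · exact Nat.lt_floor_add_one _

theorem pairwise_disjoint_gridCell {m : ℕ} (hm : 0 < m) :
    Pairwise (Function.onFun Disjoint fun p : Fin n → Fin m => gridCell m p) := by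
  intro p q hpq
  rw [Function.onFun, Set.disjoint_left]
  intro x hx hx'
  rw [mem_gridCell_iff hm] at hx hx'
  refine hpq (funext fun i => Fin.ext ?_)
  have h1 : ((p i : ℕ) : ℝ) < (q i : ℕ) + 1 := (hx i).1.trans_lt (hx' i).2
  have h2 : ((q i : ℕ) : ℝ) < (p i : ℕ) + 1 := (hx' i).1.trans_lt (hx i).2
  have h1' : (p i : ℕ) < (q i : ℕ) + 1 := by exact_mod_cast h1
  have h2' : (q i : ℕ) < (p i : ℕ) + 1 := by exact_mod_cast h2
  omega

theorem abs_integral_sub_riemannSum_le {F : (Fin n → ℝ) → ℝ} {L : ℝ≥0} (hF : LipschitzWith L F)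
    (K : ℕ) : |(∫ x in unitCube n, F x) -
      (∑ t ∈ Finset.range ((2 ^ K) ^ n), F (gridPoint n K t)) / 2 ^ (K * n)| ≤ L / 2 ^ K := by
  set m : ℕ := 2 ^ K with hmdef
  have hm : 0 < m := by positivity
  have hm' : (0 : ℝ) < m := by exact_mod_cast hm
  have hmc : (m : ℝ) = 2 ^ K := by simp [hmdef]
  have hfin : ∀ p : Fin n → Fin m, volume (gridCell m p) < ⊤ := fun p => by
    rw [gridCell, Real.volume_pi_Ico]
    exact ENNReal.prod_lt_top fun _ _ => ENNReal.ofReal_lt_top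
  have hint : ∀ p : Fin n → Fin m, IntegrableOn F (gridCell m p) := fun p => by
    have hc : IsCompact (Set.pi Set.univ fun i : Fin n =>
        Set.Icc (((p i : ℕ) : ℝ) / m) ((((p i : ℕ) : ℝ) + 1) / m)) :=
      isCompact_univ_pi fun _ => isCompact_Icc
    exact (hF.continuous.continuousOn.integrableOn_compact hc).mono_set
      (Set.pi_mono fun i _ => Set.Ico_subset_Icc_self)
  have hsum : ∑ t ∈ Finset.range (m ^ n), F (gridPoint n K t) =
      ∑ p : Fin n → Fin m, F fun i => ((p i : ℕ) : ℝ) / m := by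
    rw [← Fin.sum_univ_eq_sum_range, ← (finFunctionFinEquiv (m := m) (n := n)).symm.sum_comp]
    refine Finset.sum_congr rfl fun t _ => congrArg F (funext fun i => ?_)
    rw [finFunctionFinEquiv_symm_apply_val, gridPoint, hmc]
  have hpow : (2 : ℝ) ^ (K * n) = (m : ℝ) ^ n := by rw [hmc, pow_mul]
  rw [← iUnion_gridCell hm, integral_iUnion_fintype (fun p => measurableSet_gridCell m p)
    (pairwise_disjoint_gridCell hm) hint, hsum, hpow, Finset.sum_div, ← Finset.sum_sub_distrib]
  have hcell : ∀ p : Fin n → Fin m, |(∫ x in gridCell m p, F x) -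
      (F fun i => ((p i : ℕ) : ℝ) / m) / m ^ n| ≤ L / m * (1 / m) ^ n := by
    intro p
    set c := F fun i => ((p i : ℕ) : ℝ) / m with hc
    have e : (∫ x in gridCell m p, F x) - c / m ^ n = ∫ x in gridCell m p, (F x - c) := by
      rw [integral_sub (hint p) (integrableOn_const (hfin p).ne), setIntegral_const,
        volume_gridCell, smul_eq_mul, one_div, inv_pow, div_eq_inv_mul]
    rw [e, ← Real.norm_eq_abs, ← volume_gridCell m p]
    refine norm_setIntegral_le_of_norm_le_const (hfin p) fun x hx => ?_
    rw [← dist_eq_norm]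
    refine (hF.dist_le_mul _ _).trans ?_
    rw [div_eq_mul_one_div]
    refine mul_le_mul_of_nonneg_left ?_ L.2
    refine (dist_pi_le_iff (by positivity)).2 fun i => ?_
    have := hx i (Set.mem_univ i)
    rw [Real.dist_eq, abs_le]
    rw [Set.mem_Ico, add_div] at this
    constructor
    · have : 0 ≤ 1 / (m : ℝ) := by positivity
      linarith
    · linarith
  refine (Finset.abs_sum_le_sum_abs _ _).trans ?_
  refine (Finset.sum_le_card_nsmul _ _ _ fun p _ => hcell p).trans (le_of_eq ?_)
  rw [Finset.card_univ, Fintype.card_fun, Fintype.card_fin, Fintype.card_fin, nsmul_eq_mul, ← hmc]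
  push_cast
  rw [one_div, inv_pow]
  field_simp

/-- Where the derivative is singular, preimages of small balls are large. -/
theorem le_volume_preimage_of_singular {g : (Fin n → ℝ) → Fin n → ℝ} {L : ℝ≥0} (hL : 0 < L)
    (hg : LipschitzWith L g) {x₀ : Fin n → ℝ} {g' : (Fin n → ℝ) →L[ℝ] Fin n → ℝ}
    (hg' : HasFDerivAt g g' x₀) {w : Fin n → ℝ} (hw : w ≠ 0) (hker : g' w = 0)
    {U : Set (Fin n → ℝ)} (hU : U ∈ nhds x₀) (hUfin : volume U ≠ ⊤) (N : ℕ) :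
    ∃ δ > 0, ∀ ρ : ℝ, 0 < ρ → ρ < δ →
      N * (ρ / L) ^ n ≤ volume.real (U ∩ {x | ‖g x - g x₀‖ ≤ ρ}) := by
  have hL' : (0 : ℝ) < L := hL
  set v : Fin n → ℝ := ‖w‖⁻¹ • w with hv
  have hv1 : ‖v‖ = 1 := by
    rw [hv, norm_smul, norm_inv, norm_norm, inv_mul_cancel₀ (norm_ne_zero_iff.2 hw)]
  have hv0 : g' v = 0 := by rw [hv, map_smul, hker, smul_zero]
  -- With this `ε` the error of the linear approximation at the centres, at distance less than `N *
  -- (ρ / L)` from `x₀`, is at most `ρ / 2`; the radius `r` below leaves the other `ρ / 2` to the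
  -- Lipschitz bound.
  set ε : ℝ := L / (2 * (N + 1)) with hε
  have hε0 : 0 < ε := by positivity
  have hd := hg'.isLittleO.def hε0
  obtain ⟨r₁, hr₁, hball⟩ := Metric.mem_nhds_iff.1 (Filter.inter_mem hU hd)
  refine ⟨r₁ * L / (N + 1), by positivity, fun ρ hρ hρδ => ?_⟩
  set r : ℝ := ρ / (2 * L) with hr
  have hr0 : 0 < r := by positivity
  have h2r : 2 * r = ρ / L := by rw [hr]; field_simp
  have hLr : L * r = ρ / 2 := by rw [hr]; field_simp
  have hNr : (N + 1) * (2 * r) < r₁ := by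
    rw [h2r, ← mul_div_assoc, div_lt_iff₀ hL']
    rwa [lt_div_iff₀ (by positivity), mul_comm] at hρδ
  set c : Fin N → Fin n → ℝ := fun m => x₀ + ((m : ℕ) * (2 * r)) • v with hc
  have hcx : ∀ m, ‖c m - x₀‖ = (m : ℕ) * (2 * r) := fun m => by
    rw [hc]
    simp only [add_sub_cancel_left]
    rw [norm_smul, hv1, mul_one, Real.norm_of_nonneg (by positivity)]
  have hmN : ∀ m : Fin N, ((m : ℕ) : ℝ) + 1 ≤ N := fun m => by exact_mod_cast m.2
  have hsub : ∀ m, Metric.ball (c m) r ⊆ U ∩ {x | ‖g x - g x₀‖ ≤ ρ} := by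
    intro m x hx
    rw [Metric.mem_ball, dist_eq_norm] at hx
    have hcm := hcx m
    have hm := hmN m
    have hxx : ‖x - x₀‖ < r₁ := by
      have : ‖x - x₀‖ ≤ ‖x - c m‖ + ‖c m - x₀‖ := norm_sub_le_norm_sub_add_norm_sub _ _ _
      nlinarith
    have hcc : ‖c m - x₀‖ < r₁ := by nlinarith
    refine ⟨(hball (by rwa [Metric.mem_ball, dist_eq_norm])).1, ?_⟩
    have h1 : ‖g (c m) - g x₀ - g' (c m - x₀)‖ ≤ ε * ‖c m - x₀‖ :=
      (hball (by rwa [Metric.mem_ball, dist_eq_norm] : c m ∈ Metric.ball x₀ r₁)).2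
    have h2 : g' (c m - x₀) = 0 := by
      rw [hc]
      simp only [add_sub_cancel_left]
      rw [map_smul, hv0, smul_zero]
    rw [h2, sub_zero, hcm] at h1
    have h3 : ε * ((m : ℕ) * (2 * r)) ≤ ρ / 2 := by
      rw [h2r, hε, div_mul_eq_mul_div, div_le_iff₀ (by positivity)]
      have e : (L : ℝ) * (((m : ℕ) : ℝ) * (ρ / L)) = (m : ℕ) * ρ := by field_simp
      rw [e]
      nlinarith
    have h4 : ‖g x - g (c m)‖ ≤ ρ / 2 := by
      rw [← dist_eq_norm]
      refine (hg.dist_le_mul _ _).trans ?_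
      rw [dist_eq_norm, ← hLr]
      exact mul_le_mul_of_nonneg_left hx.le hL'.le
    have : ‖g x - g x₀‖ ≤ ‖g x - g (c m)‖ + ‖g (c m) - g x₀‖ :=
      norm_sub_le_norm_sub_add_norm_sub _ _ _
    change ‖g x - g x₀‖ ≤ ρ
    linarith
  have hdisj : Pairwise (Function.onFun Disjoint fun m => Metric.ball (c m) r) := by
    intro m m' hmm
    refine Metric.ball_disjoint_ball ?_
    have e : c m - c m' = ((((m : ℕ) : ℝ) - (m' : ℕ)) * (2 * r)) • v := by
      simp only [hc]
      rw [add_sub_add_left_eq_sub, ← sub_smul, sub_mul]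
    rw [dist_eq_norm, e, norm_smul, hv1, mul_one, norm_mul, Real.norm_of_nonneg (by positivity : 0 ≤ 2 * r)]
    have : (1 : ℝ) ≤ ‖((m : ℕ) : ℝ) - (m' : ℕ)‖ := by
      have h1 : ((m : ℕ) : ℤ) - (m' : ℕ) ≠ 0 := fun h => hmm (Fin.ext (by omega))
      have h2 := Int.one_le_abs h1
      rw [Real.norm_eq_abs]
      exact_mod_cast h2
    nlinarith
  -- In the sup norm a ball of radius `r` is a cube of side `2 * r = ρ / L`.
  have hvol : volume.real (⋃ m, Metric.ball (c m) r) = N * (ρ / L) ^ n := by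
    rw [Measure.real, measure_iUnion hdisj fun m => measurableSet_ball, tsum_fintype]
    simp only [Real.volume_pi_ball _ hr0]
    rw [Finset.sum_const, Finset.card_univ, Fintype.card_fin, Fintype.card_fin, ← h2r, nsmul_eq_mul,
      ENNReal.toReal_mul, ENNReal.toReal_ofReal (by positivity)]
    simp
  rw [← hvol]
  exact measureReal_mono (Set.iUnion_subset hsub) (measure_ne_top_of_subset Set.inter_subset_left hUfin)

/-! ### The push-forward martingale and its success -/

variable [NeZero n]

theorem lipschitzWith_treeProb_softBet {g : (Fin n → ℝ) → Fin n → ℝ} {L : ℝ≥0}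
    (hg : LipschitzWith L g) (σ : List (Fin 2)) :
    LipschitzWith (σ.length * (2 ^ (2 * σ.length + 1) * L)) fun x => treeProb (softBet (g x)) σ := by
  refine LipschitzWith.of_dist_le_mul fun x y => ?_
  have := abs_treeProb_softBet_sub_le σ (u := g x) (v := g y) (δ := L * dist x y) fun i => by
    rw [← Real.dist_eq]
    exact (dist_le_pi_dist _ _ i).trans (hg.dist_le_mul x y)
  rw [Real.dist_eq]
  push_cast
  linarith

/-- The probability that the soft binary expansion of `g x`, for `x` uniformly distributed in the
unit cube, extends `σ`. -/
noncomputable def pushProb (g : (Fin n → ℝ) → Fin n → ℝ) (σ : List (Fin 2)) : ℝ :=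
  ∫ x in unitCube n, treeProb (softBet (g x)) σ

theorem integrableOn_treeProb_softBet {g : (Fin n → ℝ) → Fin n → ℝ} {L : ℝ≥0}
    (hg : LipschitzWith L g) (σ : List (Fin 2)) :
    IntegrableOn (fun x => treeProb (softBet (g x)) σ) (unitCube n) :=
  ((lipschitzWith_treeProb_softBet hg σ).continuous.continuousOn.integrableOn_compact
    (isCompact_univ_pi fun _ => isCompact_Icc)).mono_set
      (Set.pi_mono fun _ _ => Set.Ico_subset_Icc_self)

theorem isMartingale_pushProb {g : (Fin n → ℝ) → Fin n → ℝ} {L : ℝ≥0} (hg : LipschitzWith L g) :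
    IsMartingale fun σ => 2 ^ σ.length * pushProb g σ where
  nonneg σ := mul_nonneg (by positivity)
    (integral_nonneg fun x => treeProb_nonneg (softBet_nonneg _) (softBet_le_one _) σ)
  fair σ := by
    simp only [List.length_append, List.length_singleton]
    rw [← mul_add, pushProb, pushProb, ← integral_add (integrableOn_treeProb_softBet hg _)
      (integrableOn_treeProb_softBet hg _), pow_succ]
    simp only [treeProb_add, pushProb]
    ring

theorem computableReals_pushProb {g : (Fin n → ℝ) → Fin n → ℝ} {L : ℝ≥0} (hg : LipschitzWith L g)
    (hc : ∀ i, ComputableReals fun p : ℕ × ℕ => g (gridPoint n p.1 p.2) i) :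
    ComputableReals (pushProb g) := by
  obtain ⟨κ, hκ⟩ := pow_unbounded_of_one_lt (L : ℝ) (one_lt_two : (1 : ℝ) < 2)
  -- The integrand has Lipschitz constant at most 2^(3|σ|+1+κ), by |σ| ≤ 2^|σ| and `L < 2 ^ κ`; the
  -- mesh leaves error 2^(-k).
  set mesh : List (Fin 2) × ℕ → ℕ := fun p => p.2 + (3 * p.1.length + 1 + κ) with hmesh
  have hmeshc : Primrec mesh :=
    Primrec.nat_add.comp Primrec.snd (Primrec.nat_add.comp (Primrec.nat_add.comp
      (Primrec.nat_mul.comp (Primrec.const 3) (Primrec.list_length.comp Primrec.fst))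
      (Primrec.const 1)) (Primrec.const κ))
  refine ComputableReals.of_tendsto (h := fun p => (∑ t ∈ Finset.range ((2 ^ mesh p) ^ n),
    treeProb (softBet (g (gridPoint n (mesh p) t))) p.1) / 2 ^ (mesh p * n)) ?_ fun σ k => ?_
  · refine ComputableReals.div_two_pow (ComputableReals.sum_range
      (g := fun r : (List (Fin 2) × ℕ) × ℕ =>
        treeProb (softBet (g (gridPoint n (mesh r.1) r.2))) r.1.1) ?_ ?_) ?_
    · have := computableReals_treeProb (computableReals_softBet hc)
        (fun _ => softBet_nonneg _ _) (fun _ => softBet_le_one _ _)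
      refine this.comp (h := fun r : (List (Fin 2) × ℕ) × ℕ => ((mesh r.1, r.2), r.1.1)) ?_
      exact ((hmeshc.to_comp.comp Computable.fst).pair Computable.snd).pair
        (Computable.fst.comp Computable.fst)
    · exact (primrec_natPow.comp (primrec_two_pow.comp hmeshc) (Primrec.const n)).to_comp
    · exact (Primrec.nat_mul.comp hmeshc (Primrec.const n)).to_comp
  · refine (abs_integral_sub_riemannSum_le (lipschitzWith_treeProb_softBet hg σ)
      (mesh (σ, k))).trans ?_
    have hlen : (σ.length : ℝ) ≤ 2 ^ σ.length := by exact_mod_cast Nat.lt_two_pow_self.le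
    push_cast
    rw [div_le_iff₀ (by positivity)]
    calc (σ.length : ℝ) * (2 ^ (2 * σ.length + 1) * L)
        ≤ 2 ^ σ.length * (2 ^ (2 * σ.length + 1) * 2 ^ κ) := by gcongr
      _ = (1 / 2) ^ k * 2 ^ mesh (σ, k) := by
        simp only [hmesh]
        rw [pow_add 2 k, ← mul_assoc ((1 / 2 : ℝ) ^ k), ← mul_pow]
        norm_num
        ring

/-- If `v` is the image of an interior point of the unit cube where `g` has a singular derivative,
then the expansion of `v` is not computably random. -/
theorem not_seqComputablyRandom_of_singular {g : (Fin n → ℝ) → Fin n → ℝ} {L : ℝ≥0} (hL : 0 < L)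
    (hg : LipschitzWith L g)
    (hc : ∀ i, ComputableReals fun p : ℕ × ℕ => g (gridPoint n p.1 p.2) i)
    {x₀ : Fin n → ℝ} (hx₀ : unitCube n ∈ nhds x₀) {g' : (Fin n → ℝ) →L[ℝ] Fin n → ℝ}
    (hg' : HasFDerivAt g g' x₀) {w : Fin n → ℝ} (hw : w ≠ 0) (hker : g' w = 0)
    {Z : ℕ → Fin 2} (hdig : ∀ i : Fin n, IsDigits (fun t => Z (t * n + i)) (g x₀ i)) :
    ¬ SeqComputablyRandom Z := by
  intro hZ
  have hn : 0 < n := Nat.pos_of_neZero n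
  have hL' : (0 : ℝ) < L := hL
  obtain ⟨B, hB⟩ := hZ.eventually_not_run hn
  obtain ⟨C, hC⟩ := hZ.bounded (isMartingale_pushProb hg)
    ((computableReals_pushProb hg hc).two_pow_mul Computable.list_length)
  -- Chosen so that the final lower bound `N / (2 ^ B * (8 * L) ^ n)` for the capital exceeds `C`.
  -- The 8 comes from `ρ = 1 / 2 ^ (k + 3)`.
  obtain ⟨N, hN⟩ := exists_nat_gt (C * (2 ^ B * (8 * L) ^ n))
  obtain ⟨δ, hδ, hvol⟩ := le_volume_preimage_of_singular hL hg hg' hw hker hx₀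
    (by rw [volume_unitCube]; exact ENNReal.one_ne_top) N
  obtain ⟨k₀, hk₀⟩ := exists_pow_lt_of_lt_one hδ (by norm_num : (1 / 2 : ℝ) < 1)
  -- In the interleaved sequence, `n` zeros followed by `n` ones give digits 0, 1 in every
  -- coordinate at once.
  obtain ⟨k, hkk, hk⟩ := hZ.frequently_pattern hn (fun i => if i < n then 0 else 1) (2 * n) k₀
  have hmid : ∀ i < n, Z (k * n + i) = 0 ∧ Z ((k + 1) * n + i) = 1 := by
    intro i hi
    have h1 := hk i (by omega)
    have h2 := hk (n + i) (by omega)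
    rw [if_pos hi] at h1
    rw [if_neg (by omega)] at h2
    exact ⟨h1, by rw [← h2]; congr 1; ring⟩
  set ρ : ℝ := 1 / 2 ^ (k + 3) with hρ
  have hρ0 : 0 < ρ := by positivity
  have hρδ : ρ < δ := by
    refine lt_of_le_of_lt ?_ hk₀
    rw [hρ, one_div_pow]
    exact one_div_le_one_div_of_le (by positivity) (pow_le_pow_right₀ (by norm_num) (by omega))
  have hV := hvol ρ hρ0 hρδ
  set S : Set (Fin n → ℝ) := unitCube n ∩ {x | ‖g x - g x₀‖ ≤ ρ} with hS
  have hSm : MeasurableSet S := measurableSet_unitCube.inter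
    ((isClosed_le ((hg.continuous.sub continuous_const).norm) continuous_const).measurableSet)
  have hSfin : volume S ≠ ⊤ := measure_ne_top_of_subset Set.inter_subset_left
    (by rw [volume_unitCube]; exact ENNReal.one_ne_top)
  have hpush : (1 / 2) ^ B * volume.real S ≤ pushProb g (initSeg Z (k * n)) := by
    calc (1 / 2) ^ B * volume.real S = ∫ _ in S, (1 / 2 : ℝ) ^ B := by
          rw [setIntegral_const, smul_eq_mul, mul_comm]
      _ ≤ ∫ x in S, treeProb (softBet (g x)) (initSeg Z (k * n)) := by
          refine setIntegral_mono_on (integrableOn_const hSfin)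
            ((integrableOn_treeProb_softBet hg _).mono_set Set.inter_subset_left) hSm fun x hx => ?_
          refine le_treeProb_softBet hdig hB hmid fun i => ?_
          have := (norm_le_pi_norm (g x - g x₀) i).trans hx.2
          rwa [Pi.sub_apply, Real.norm_eq_abs] at this
      _ ≤ pushProb g (initSeg Z (k * n)) :=
          setIntegral_mono_set (integrableOn_treeProb_softBet hg _)
            (Filter.Eventually.of_forall fun x =>
              treeProb_nonneg (softBet_nonneg _) (softBet_le_one _) _)
            (Filter.Eventually.of_forall Set.inter_subset_left)
  have hbound := hC (k * n)
  simp only [length_initSeg] at hbound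
  have h1 : 2 ^ (k * n) * ((1 / 2) ^ B * (N * (ρ / L) ^ n)) ≤ C := by
    refine le_trans ?_ hbound
    gcongr
    refine le_trans ?_ hpush
    gcongr
  -- The factor 2^(kn) of the martingale cancels the volume scale of the cube, so the bound does not
  -- depend on `k`.
  have h2 : 2 ^ (k * n) * ((1 / 2) ^ B * (N * (ρ / L) ^ n)) = N / (2 ^ B * (8 * L) ^ n) := by
    have e : ρ / L = 1 / (2 ^ k * (8 * L)) := by
      rw [hρ, pow_add]; field_simp; norm_num
    rw [e, pow_mul, one_div_pow, one_div_pow, mul_pow (2 ^ k)]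
    field_simp
  rw [h2, div_le_iff₀ (by positivity)] at h1
  linarith

end CompRandom

/-! ### Reduction to the unit cube -/

open CompRandom in
theorem mainTheorem2 {n : ℕ} [NeZero n]
    (f : EuclideanSpace ℝ (Fin n) → EuclideanSpace ℝ (Fin n))
    (hf : CompRandom.ComputableMap f) (hLip : ∃ K : ℝ≥0, LipschitzWith K f)
    (z : EuclideanSpace ℝ (Fin n)) (hz : CompRandom.ComputablyRandom (f z))
    (f' : EuclideanSpace ℝ (Fin n) →L[ℝ] EuclideanSpace ℝ (Fin n)) (hf' : HasFDerivAt f f' z) :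
    f'.det ≠ 0 := by
  intro hdet
  have hn : 0 < n := Nat.pos_of_neZero n
  obtain ⟨K, hK⟩ := hLip
  obtain ⟨v, hv, hv0⟩ : ∃ v, f' v = 0 ∧ v ≠ 0 := by
    have := LinearMap.bot_lt_ker_of_det_eq_zero (f := (f' : EuclideanSpace ℝ (Fin n) →ₗ[ℝ] _)) hdet
    obtain ⟨v, hv, hv0⟩ := (Submodule.ne_bot_iff _).1 this.ne'
    exact ⟨v, hv, hv0⟩
  set E := EuclideanSpace.equiv (Fin n) ℝ with hE
  -- The integer shift and the factor 2 put each coordinate of `x₀` in [1/2, 1), hence `x₀` in the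
  -- interior of the cube, while keeping `A` computable. Subtracting the integer parts `a` turns the
  -- value into its fractional part.
  set c : Fin n → ℝ := fun i => ((⌊z i⌋ - 1 : ℤ) : ℝ) with hc
  set a : Fin n → ℝ := fun i => ((⌊f z i⌋ : ℤ) : ℝ) with ha
  set A : (Fin n → ℝ) → EuclideanSpace ℝ (Fin n) := fun x => E.symm (c + (2 : ℝ) • x) with hA
  set g : (Fin n → ℝ) → Fin n → ℝ := fun x => E (f (A x)) - a with hg
  set x₀ : Fin n → ℝ := (1 / 2 : ℝ) • (E z - c) with hx₀
  have hAx₀ : A x₀ = z := by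
    simp only [hA, hx₀, smul_smul]
    norm_num
  have hgx₀ : ∀ i, g x₀ i = Int.fract (f z i) := fun i => by
    simp only [hg, hAx₀]
    rfl
  have hAd : HasFDerivAt A ((E.symm : (Fin n → ℝ) →L[ℝ] EuclideanSpace ℝ (Fin n)).comp
      ((2 : ℝ) • ContinuousLinearMap.id ℝ (Fin n → ℝ))) x₀ :=
    E.symm.hasFDerivAt.comp x₀ (((hasFDerivAt_id x₀).const_smul (2 : ℝ)).const_add c)
  have hgd : HasFDerivAt g ((E : EuclideanSpace ℝ (Fin n) →L[ℝ] (Fin n → ℝ)).comp (f'.comp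
      ((E.symm : (Fin n → ℝ) →L[ℝ] EuclideanSpace ℝ (Fin n)).comp
      ((2 : ℝ) • ContinuousLinearMap.id ℝ (Fin n → ℝ))))) x₀ := by
    refine HasFDerivAt.sub_const a (E.hasFDerivAt.comp x₀ (HasFDerivAt.comp x₀ ?_ hAd))
    rwa [hAx₀]
  obtain ⟨L, hL, hgL⟩ : ∃ L : ℝ≥0, 0 < L ∧ LipschitzWith L g := by
    have h1 : ∃ L, LipschitzWith L g := by
      have hA1 : LipschitzWith ‖(2 : ℝ)‖₊ fun x : Fin n → ℝ => c + (2 : ℝ) • x :=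
        LipschitzWith.of_dist_le_mul fun x y => by
          rw [dist_add_left, dist_smul₀]; rfl
      have hsub : LipschitzWith 1 fun x : Fin n → ℝ => x - a :=
        LipschitzWith.of_dist_le_mul fun x y => by simp
      exact ⟨_, hsub.comp (E.lipschitz.comp (hK.comp (E.symm.lipschitz.comp hA1)))⟩
    obtain ⟨L, hL⟩ := h1
    exact ⟨L + 1, by positivity, hL.weaken (by simp)⟩
  have hnhds : unitCube n ∈ nhds x₀ := by
    refine set_pi_mem_nhds Set.finite_univ fun i _ => Ico_mem_nhds ?_ ?_
    · have := Int.floor_le (z i)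
      have e : x₀ i = 1 / 2 * (z i - (⌊z i⌋ - 1 : ℤ)) := rfl
      rw [e]; push_cast; linarith
    · have := Int.lt_floor_add_one (z i)
      have e : x₀ i = 1 / 2 * (z i - (⌊z i⌋ - 1 : ℤ)) := rfl
      rw [e]; push_cast; linarith
  have hcomp : ∀ i, ComputableReals fun p : ℕ × ℕ => g (gridPoint n p.1 p.2) i := by
    intro i
    -- Computable maps act on sequences, so the pair of mesh and grid index is coded by one natural
    -- number.
    have hseq : ComputableSeq fun m : ℕ => A (gridPoint n m.unpair.1 m.unpair.2) := by
      intro i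
      have h1 : Primrec fun m : ℕ => 2 ^ m.unpair.1 :=
        primrec_two_pow.comp (Primrec.fst.comp Primrec.unpair)
      have h2 : Primrec fun m : ℕ => m.unpair.2 / (2 ^ m.unpair.1) ^ (i : ℕ) % 2 ^ m.unpair.1 :=
        Primrec.nat_mod.comp (Primrec.nat_div.comp (Primrec.snd.comp Primrec.unpair)
          (primrec_natPow.comp h1 (Primrec.const _))) h1
      have h3 := (ComputableReals.intCast (Computable.const (α := ℕ) (⌊z i⌋ - 1))).add
        (((ComputableReals.natCast h2.to_comp).div_two_pow
          (Computable.fst.comp Computable.unpair)).two_pow_mul (Computable.const 1))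
      simp only [pow_one] at h3
      exact h3
    have := ((hf.seq _ hseq i).comp Primrec₂.natPair.to_comp).sub
      (ComputableReals.intCast (Computable.const (α := ℕ × ℕ) ⌊f z i⌋))
    simp only [Nat.unpair_pair] at this
    exact this
  refine not_seqComputablyRandom_of_singular hL hgL hcomp hnhds hgd (w := E v) (by simpa using hv0)
    ?_ (fun i => ?_) hz
  · simp [hv]
  · rw [hgx₀]
    have e : (fun t => binaryExpansion (f z) (t * n + i)) = Real.digits (Int.fract (f z i)) 2 := by
      funext t
      have h1 : Fin.ofNat n (t * n + i) = i := Fin.ext (by simp [Nat.mod_eq_of_lt i.2])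
      have h2 : (t * n + i) / n = t := by
        rw [mul_comm, Nat.mul_add_div hn, Nat.div_eq_of_lt i.2, add_zero]
      rw [binaryExpansion, h1, h2]
    rw [e]
    exact isDigits_digits ⟨Int.fract_nonneg _, Int.fract_lt_one _⟩
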